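/- Let $X$ and $Y$ be Polish spaces with their Borel $\sigma$-fields, let $\mu$ and $\nu$ be Borel probability measures on $X$ and $Y$, let $c:X\times Y\to[0,\infty)$ be measurable, let $\varepsilon>0$, and put $P=\mu\otimes\nu$. Let $\Pi(\mu,\nu)$ be the set of couplings, i.e. of probability measures on $X\times Y$ with marginals $\mu$ and $\nu$. For a probability measure $\pi$ on $X\times Y$ let $H(\pi|P)=\int\log\frac{d\pi}{dP}\,d\pi$ if $\pi\ll P$, and $H(\pi|P)=\infty$ otherwise. A coupling $\pi\in\Pi(\mu,\nu)$ is called $(c,\varepsilon)$-cyclically invariant if $\pi$ and $P$ are mutually absolutely continuous and the density $d\pi/dP$ admits a (measurable) version $Z:X\times Y\to(0,\infty)$ such that $$\prod_{i=1}^k Z(x_i,y_i)=\exp\Big(-\frac1\varepsilon\Big[\sum_{i=1}^k c(x_i,y_i)-\sum_{i=1}^k c(x_i,y_{i+1})\Big]\Big)\prod_{i=1}^k Z(x_i,y_{i+1})$$ for all $k\in\mathbb N$ and all $(x_1,y_1),\dots,(x_k,y_k)\in X\times Y$, where $y_{k+1}:=y_1$. (a) There is at most one $(c,\varepsilon)$-cyclically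 invariant coupling $\pi\in\Pi(\mu,\nu)$. (b) Suppose that there exists $\pi\in\Pi(\mu,\nu)$ with $\int c\,d\pi+H(\pi|P)<\infty$. Then a coupling $\pi\in\Pi(\mu,\nu)$ is $(c,\varepsilon)$-cyclically invariant if and only if it minimizes the entropic optimal transport problem $$\inf_{\pi\in\Pi(\mu,\nu)}\int_{X\times Y} c\,d\pi+\varepsilon H(\pi|P).$$ Moreover, there exists a unique such coupling. -/

import Mathlib

open MeasureTheory
open scoped ENNReal NNReal

namespace EntropicOT

variable {X Y : Type*} [MeasurableSpace X] [MeasurableSpace Y]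

/-- `Π(μ, ν)`: the probability measures on `X × Y` with marginals `μ` and `ν`. -/
def couplings (μ : Measure X) (ν : Measure Y) : Set (Measure (X × Y)) :=
  {π | IsProbabilityMeasure π ∧ π.map Prod.fst = μ ∧ π.map Prod.snd = ν}

/-- The objective `∫ c dπ + ε H(π | μ ⊗ ν)` of the entropic optimal transport problem, with values
in `[0, ∞]`. For probability measures, `klDiv π P` is `∫ log (dπ/dP) dπ` if `π ≪ P` (the negative
part of the integrand is always integrable, so this is `∞` exactly if the integrand is not
integrable), and `∞` if `π` is not absolutely continuous with respect to `P`. -/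
noncomputable def entropicCost (c : X × Y → ℝ≥0) (ε : ℝ) (μ : Measure X) (ν : Measure Y)
    (π : Measure (X × Y)) : ℝ≥0∞ :=
  (∫⁻ z, (c z : ℝ≥0∞) ∂π) + ENNReal.ofReal ε * InformationTheory.klDiv π (μ.prod ν)

/-- `π` minimizes the entropic optimal transport problem over `Π(μ, ν)`. -/
def IsEntropicOptimal (c : X × Y → ℝ≥0) (ε : ℝ) (μ : Measure X) (ν : Measure Y)
    (π : Measure (X × Y)) : Prop :=
  π ∈ couplings μ ν ∧ IsMinOn (entropicCost c ε μ ν) (couplings μ ν) π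

/-- `π` is a `(c, ε)`-cyclically invariant coupling of `μ` and `ν`: it is equivalent to
`P = μ ⊗ ν`, and its density has a version `Z : X × Y → (0, ∞)` that satisfies the cyclical
identity at all finite families of points. The cyclic successor `i ↦ i + 1` of indices
is `finRotate k`. -/
def IsCyclicallyInvariant (c : X × Y → ℝ≥0) (ε : ℝ) (μ : Measure X) (ν : Measure Y)
    (π : Measure (X × Y)) : Prop :=
  π ∈ couplings μ ν ∧ π ≪ μ.prod ν ∧ μ.prod ν ≪ π ∧
    ∃ Z : X × Y → ℝ, Measurable Z ∧ (∀ z, 0 < Z z) ∧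
      π = (μ.prod ν).withDensity (fun z => ENNReal.ofReal (Z z)) ∧
      ∀ (k : ℕ) (x : Fin k → X) (y : Fin k → Y),
        ∏ i, Z (x i, y i) =
          Real.exp (-(1 / ε) *
            (∑ i, (c (x i, y i) : ℝ) - ∑ i, (c (x i, y (finRotate k i)) : ℝ))) *
          ∏ i, Z (x i, y (finRotate k i))

end EntropicOT

namespace EntropicOT

open Filter Topology InformationTheory

set_option linter.unusedSectionVars false

variable {X Y : Type*} [MeasurableSpace X] [MeasurableSpace Y]

/-! Write couplings through their densities with respect to P = μ ⊗ ν. The cyclical identity for two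
points, one of them fixed, says that the density has the form a(x) b(y) exp(-c/ε); conversely every
such positive density satisfies all the cyclical identities, since the factors a and b merely get
permuted.

Uniqueness (`ae_eq_of_separable`): for two such densities, the log-ratio is a sum u(x) + v(y). Equal
marginals make any bounded function of one coordinate integrate to zero against Z - Z', while a
bounded odd increasing transform of u and v gives an integrand that is strictly positive wherever Z
≠ Z'.

Existence of a minimizer (`exists_isEntropicOptimal`): the entropy is uniformly convex in the
Hellinger distance (`klFun_midpoint`), so a minimizing sequence is Cauchy in L¹; marginals pass to
the limit and Fatou's lemma bounds the cost.

A minimizer is cyclically invariant (`measure_exchangeSet_eq_zero`): if swapping second coordinates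
increased the product of tilted densities on a set of pairs of positive measure, moving a little
mass from those pairs' exchanges to the pairs themselves would keep the marginals and lower the
cost. Hence the two-point identity holds almost everywhere; fixing a good point by Fubini gives
separability, and the marginals force a, b > 0 almost everywhere.

That cyclically invariant couplings are optimal then follows from uniqueness: they equal the
minimizer. -/

/-- `Z` is a nonnegative density, with respect to `μ ⊗ ν`, of a coupling of `μ` and `ν`. -/
structure IsCouplingDensity (μ : Measure X) (ν : Measure Y) (Z : X × Y → ℝ) : Prop where
  measurable : Measurable Z
  nonneg : ∀ z, 0 ≤ Z z
  integrable : Integrable Z (μ.prod ν)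
  setIntegral_fst : ∀ A, MeasurableSet A → ∫ z in Prod.fst ⁻¹' A, Z z ∂(μ.prod ν) = μ.real A
  setIntegral_snd : ∀ B, MeasurableSet B → ∫ z in Prod.snd ⁻¹' B, Z z ∂(μ.prod ν) = ν.real B

/-- The integrand of the entropic optimal transport problem at the density value `s`. -/
noncomputable def entropicIntegrand (c : X × Y → ℝ≥0) (ε : ℝ) (z : X × Y) (s : ℝ) : ℝ :=
  c z * s + ε * klFun s

/-- The measure with real density `Z` with respect to `μ ⊗ ν`. -/
noncomputable def ofDensity (μ : Measure X) (ν : Measure Y) (Z : X × Y → ℝ) : Measure (X × Y) :=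
  (μ.prod ν).withDensity fun z => ENNReal.ofReal (Z z)

/-! ### Couplings and their densities -/

section Density

lemma entropicIntegrand_nonneg {X Y : Type*} {c : X × Y → ℝ≥0} {ε : ℝ} (hε : 0 ≤ ε) {s : ℝ} (hs : 0 ≤ s) (z : X × Y) :
    0 ≤ entropicIntegrand c ε z s :=
  add_nonneg (mul_nonneg (c z).2 hs) (mul_nonneg hε (klFun_nonneg hs))

variable {μ : Measure X} {ν : Measure Y} {c : X × Y → ℝ≥0} {ε : ℝ} {Z : X × Y → ℝ}

lemma ofDensity_apply (hZ : Integrable Z (μ.prod ν)) (h0 : ∀ z, 0 ≤ Z z) {s : Set (X × Y)}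
    (hs : MeasurableSet s) :
    ofDensity μ ν Z s = ENNReal.ofReal (∫ z in s, Z z ∂(μ.prod ν)) := by
  rw [ofDensity, withDensity_apply _ hs,
    ofReal_integral_eq_lintegral_ofReal hZ.integrableOn (Eventually.of_forall h0)]

lemma absolutelyContinuous_of_entropicCost_ne_top (hε : 0 < ε) {π : Measure (X × Y)}
    (h : entropicCost c ε μ ν π ≠ ∞) : π ≪ μ.prod ν := by
  by_contra hac
  apply h
  rw [entropicCost, klDiv_of_not_ac hac, ENNReal.mul_top (by simpa using hε), add_top]

lemma integral_ofDensity (hZ : Measurable Z) (h0 : ∀ z, 0 ≤ Z z) (f : X × Y → ℝ) :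
    ∫ z, f z ∂(ofDensity μ ν Z) = ∫ z, f z * Z z ∂(μ.prod ν) := by
  rw [ofDensity, integral_withDensity_eq_integral_toReal_smul hZ.ennreal_ofReal
    (Eventually.of_forall fun _ => ENNReal.ofReal_lt_top)]
  refine integral_congr_ae (Eventually.of_forall fun z => ?_)
  simp only [smul_eq_mul, ENNReal.toReal_ofReal (h0 z), mul_comm]

variable [IsProbabilityMeasure μ] [IsProbabilityMeasure ν]

lemma IsCouplingDensity.map_fst (hZ : IsCouplingDensity μ ν Z) :
    (ofDensity μ ν Z).map Prod.fst = μ := by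
  ext A hA
  rw [Measure.map_apply measurable_fst hA, ofDensity_apply hZ.integrable hZ.nonneg
    (measurable_fst hA), hZ.setIntegral_fst A hA, ofReal_measureReal]

lemma IsCouplingDensity.map_snd (hZ : IsCouplingDensity μ ν Z) :
    (ofDensity μ ν Z).map Prod.snd = ν := by
  ext A hA
  rw [Measure.map_apply measurable_snd hA, ofDensity_apply hZ.integrable hZ.nonneg
    (measurable_snd hA), hZ.setIntegral_snd A hA, ofReal_measureReal]

lemma IsCouplingDensity.mem_couplings (hZ : IsCouplingDensity μ ν Z) :
    ofDensity μ ν Z ∈ couplings μ ν := by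
  refine ⟨⟨?_⟩, hZ.map_fst, hZ.map_snd⟩
  rw [← Set.preimage_univ (f := Prod.fst), ← Measure.map_apply measurable_fst MeasurableSet.univ,
    hZ.map_fst, measure_univ]

lemma isCouplingDensity_of_mem_couplings (hm : Measurable Z) (h0 : ∀ z, 0 ≤ Z z)
    (hπ : ofDensity μ ν Z ∈ couplings μ ν) : IsCouplingDensity μ ν Z := by
  obtain ⟨hp, h1, h2⟩ := hπ
  have hi : Integrable Z (μ.prod ν) := by
    refine ⟨hm.aestronglyMeasurable, ?_⟩
    rw [hasFiniteIntegral_iff_ofReal (Eventually.of_forall h0)]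
    have := hp.measure_univ
    rw [ofDensity, withDensity_apply _ MeasurableSet.univ, Measure.restrict_univ] at this
    simp [this]
  have key : ∀ s, MeasurableSet s → ∫ z in s, Z z ∂(μ.prod ν) = (ofDensity μ ν Z).real s := by
    intro s hs
    rw [measureReal_def, ofDensity_apply hi h0 hs, ENNReal.toReal_ofReal]
    exact integral_nonneg h0
  refine ⟨hm, h0, hi, fun A hA => ?_, fun B hB => ?_⟩
  · rw [key _ (measurable_fst hA), measureReal_def, ← Measure.map_apply measurable_fst hA, h1]; rfl
  · rw [key _ (measurable_snd hB), measureReal_def, ← Measure.map_apply measurable_snd hB, h2]; rfl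

lemma exists_eq_ofDensity {π : Measure (X × Y)} (hπ : π ∈ couplings μ ν) (hac : π ≪ μ.prod ν) :
    ∃ Z, IsCouplingDensity μ ν Z ∧ π = ofDensity μ ν Z := by
  have := hπ.1
  have h : π = ofDensity μ ν fun z => (π.rnDeriv (μ.prod ν) z).toReal := by
    conv_lhs => rw [← Measure.withDensity_rnDeriv_eq _ _ hac]
    refine withDensity_congr_ae ?_
    filter_upwards [Measure.rnDeriv_lt_top π (μ.prod ν)] with z hz
    rw [ENNReal.ofReal_toReal hz.ne]
  refine ⟨_, isCouplingDensity_of_mem_couplings (Measure.measurable_rnDeriv _ _).ennreal_toReal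
    (fun _ => ENNReal.toReal_nonneg) (h ▸ hπ), h⟩

lemma IsCouplingDensity.congr_ae {Z' : X × Y → ℝ} (hZ : IsCouplingDensity μ ν Z)
    (hm : Measurable Z') (h0 : ∀ z, 0 ≤ Z' z) (h : Z =ᵐ[μ.prod ν] Z') :
    ofDensity μ ν Z = ofDensity μ ν Z' ∧ IsCouplingDensity μ ν Z' := by
  have : ofDensity μ ν Z = ofDensity μ ν Z' :=
    withDensity_congr_ae (h.mono fun z hz => by simp only [hz])
  exact ⟨this, isCouplingDensity_of_mem_couplings hm h0 (this ▸ hZ.mem_couplings)⟩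

lemma measurable_entropicIntegrand (hc : Measurable c) (hZ : Measurable Z) :
    Measurable fun z => entropicIntegrand c ε z (Z z) := by
  have := measurable_klFun
  unfold entropicIntegrand
  fun_prop

/-- The correction 1 - s in `klFun s` integrates to zero and makes the integrand nonnegative, so
that no integrability questions arise and Fatou's lemma applies. -/
lemma entropicCost_ofDensity (hc : Measurable c) (hε : 0 ≤ ε) (hZ : IsCouplingDensity μ ν Z) :
    entropicCost c ε μ ν (ofDensity μ ν Z) =
      ∫⁻ z, ENNReal.ofReal (entropicIntegrand c ε z (Z z)) ∂(μ.prod ν) := by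
  have := hZ.mem_couplings.1
  have hac : ofDensity μ ν Z ≪ μ.prod ν := withDensity_absolutelyContinuous _ _
  have hk : Measurable fun z => klFun (Z z) := measurable_klFun.comp hZ.measurable
  rw [entropicCost, klDiv_eq_lintegral_klFun_of_ac hac]
  have h1 : ∫⁻ z, ENNReal.ofReal (klFun ((ofDensity μ ν Z).rnDeriv (μ.prod ν) z).toReal)
      ∂(μ.prod ν) = ∫⁻ z, ENNReal.ofReal (klFun (Z z)) ∂(μ.prod ν) := by
    refine lintegral_congr_ae ?_
    filter_upwards [Measure.rnDeriv_withDensity (μ.prod ν) hZ.measurable.ennreal_ofReal] with z hz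
    rw [ofDensity, hz, ENNReal.toReal_ofReal (hZ.nonneg z)]
  rw [h1, ofDensity, lintegral_withDensity_eq_lintegral_mul _ hZ.measurable.ennreal_ofReal
    (by fun_prop), ← lintegral_const_mul _ hk.ennreal_ofReal, ← lintegral_add_left
    (by have := hZ.measurable; fun_prop)]
  refine lintegral_congr fun z => ?_
  rw [eq_comm, entropicIntegrand, ENNReal.ofReal_add (mul_nonneg (c z).coe_nonneg (hZ.nonneg z))
    (mul_nonneg hε (klFun_nonneg (hZ.nonneg z))), ENNReal.ofReal_mul hε,
    ENNReal.ofReal_mul (c z).coe_nonneg, ENNReal.ofReal_coe_nnreal, Pi.mul_apply, mul_comm (ENNReal.ofReal (Z z))]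

end Density

/-! ### Convexity inequalities for s log s -/

section Real

/-- Multiply log √x ≥ 1 - 1/√x by 2x. -/
lemma sq_sqrt_sub_one_le_klFun {x : ℝ} (hx : 0 ≤ x) : (√x - 1) ^ 2 ≤ klFun x := by
  rw [klFun_apply]
  rcases hx.eq_or_lt with rfl | hx'
  · simp
  have hs : 0 < √x := Real.sqrt_pos.2 hx'
  have h1 := Real.one_sub_inv_le_log_of_pos hs
  have h2 : Real.log √x = Real.log x / 2 := Real.log_sqrt hx
  have h3 : x * (√x)⁻¹ = √x := by
    nth_rewrite 1 [← Real.mul_self_sqrt hx]; field_simp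
  have h4 := mul_le_mul_of_nonneg_left h1 hx
  rw [mul_sub, h3, h2] at h4
  nlinarith [Real.sq_sqrt hx]

lemma sq_sqrt_sub_sqrt_le_mul_log {a m : ℝ} (ha : 0 ≤ a) (hm : 0 < m) :
    (√a - √m) ^ 2 ≤ a * Real.log (a / m) + m - a := by
  have h := mul_le_mul_of_nonneg_left (sq_sqrt_sub_one_le_klFun (div_nonneg ha hm.le)) hm.le
  rw [klFun_apply, Real.sqrt_div ha] at h
  have hs : 0 < √m := Real.sqrt_pos.2 hm
  have e1 : m * (√a / √m - 1) ^ 2 = (√a - √m) ^ 2 := by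
    have : m = √m ^ 2 := (Real.sq_sqrt hm.le).symm
    nth_rewrite 1 [this]; field_simp
  have e2 : m * (a / m * Real.log (a / m) + 1 - a / m) = a * Real.log (a / m) + m - a := by
    field_simp
  rwa [e1, e2] at h

/-- Uniform convexity in the Hellinger distance: with m the midpoint, the convexity gap is the
relative entropy of a and b to m, at least (√a - √m)² + (√b - √m)² ≥ (√a - √b)² / 2. -/
lemma klFun_midpoint {a b : ℝ} (ha : 0 ≤ a) (hb : 0 ≤ b) :
    2 * klFun ((a + b) / 2) + (√a - √b) ^ 2 / 2 ≤ klFun a + klFun b := by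
  set m := (a + b) / 2 with hm
  rcases (show 0 ≤ m by positivity).eq_or_lt with h0 | h0
  · have ha' : a = 0 := by linarith
    have hb' : b = 0 := by linarith
    subst ha' hb'
    simp [← h0]; linarith
  have key : ∀ x, 0 ≤ x → x * Real.log (x / m) = x * Real.log x - x * Real.log m := by
    intro x hx
    rcases hx.eq_or_lt with rfl | hx
    · simp
    · rw [Real.log_div hx.ne' h0.ne']; ring
  have h1 := sq_sqrt_sub_sqrt_le_mul_log ha h0
  have h2 := sq_sqrt_sub_sqrt_le_mul_log hb h0
  rw [key _ ha] at h1
  rw [key _ hb] at h2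
  simp only [klFun_apply]
  have h3 : 2 * (m * Real.log m) = a * Real.log m + b * Real.log m := by rw [hm]; ring
  nlinarith [sq_nonneg (√a + √b - 2 * √m)]

/-- Factor a - b through the square roots and apply the weighted AM-GM inequality; this turns
Hellinger bounds into L¹ bounds. -/
lemma abs_sub_le_sq_sqrt_sub_sqrt {a b l : ℝ} (ha : 0 ≤ a) (hb : 0 ≤ b) (hl : 0 < l) :
    |a - b| ≤ (√a - √b) ^ 2 / (2 * l) + l * (a + b) := by
  have e : a - b = (√a - √b) * (√a + √b) := by
    nlinarith [Real.sq_sqrt ha, Real.sq_sqrt hb]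
  have h1 : (√a + √b) ^ 2 ≤ 2 * (a + b) := by
    nlinarith [Real.sq_sqrt ha, Real.sq_sqrt hb, sq_nonneg (√a - √b)]
  rw [e, abs_mul, abs_of_nonneg (show 0 ≤ √a + √b by positivity), ← sq_abs (√a - √b)]
  set p := |√a - √b|
  set q := √a + √b
  have : p * q ≤ p ^ 2 / (2 * l) + l / 2 * q ^ 2 := by
    have : p ^ 2 / (2 * l) + l / 2 * q ^ 2 - p * q = (p - l * q) ^ 2 / (2 * l) := by
      field_simp; ring
    have : 0 ≤ (p - l * q) ^ 2 / (2 * l) := by positivity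
    linarith
  nlinarith

/-- The tangent line is taken at r, not at s, so that s = 0 is allowed although the slope there is
-∞. -/
lemma klFun_sub_le {s r : ℝ} (hs : 0 ≤ s) (hr : 0 < r) :
    klFun r - klFun s ≤ (r - s) * Real.log r := by
  have h := sq_sqrt_sub_sqrt_le_mul_log hs hr
  have h' := sq_nonneg (√s - √r)
  have : s * Real.log (s / r) = s * Real.log s - s * Real.log r := by
    rcases hs.eq_or_lt with rfl | hs
    · simp
    · rw [Real.log_div hs.ne' hr.ne']; ring
  simp only [klFun_apply]
  nlinarith

end Real

/-! ### Uniqueness of cyclically invariant couplings -/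

section Uniqueness

variable {μ : Measure X} [IsProbabilityMeasure μ] {ν : Measure Y} [IsProbabilityMeasure ν]
  {c : X × Y → ℝ≥0} {ε : ℝ} {Z Z' : X × Y → ℝ}

lemma IsCouplingDensity.integral_comp_fst_mul (hZ : IsCouplingDensity μ ν Z) {f : X → ℝ}
    (hf : Measurable f) : ∫ z, f z.1 * Z z ∂(μ.prod ν) = ∫ x, f x ∂μ := by
  rw [← integral_ofDensity hZ.measurable hZ.nonneg (fun z => f z.1)]
  conv_rhs => rw [← hZ.map_fst]
  rw [integral_map measurable_fst.aemeasurable hf.aestronglyMeasurable]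

lemma IsCouplingDensity.integral_comp_snd_mul (hZ : IsCouplingDensity μ ν Z) {f : Y → ℝ}
    (hf : Measurable f) : ∫ z, f z.2 * Z z ∂(μ.prod ν) = ∫ y, f y ∂ν := by
  rw [← integral_ofDensity hZ.measurable hZ.nonneg (fun z => f z.2)]
  conv_rhs => rw [← hZ.map_snd]
  rw [integral_map measurable_snd.aemeasurable hf.aestronglyMeasurable]

lemma abs_arctan_le_two (t : ℝ) : |Real.arctan t| ≤ 2 := by
  have h1 := Real.arctan_lt_pi_div_two t
  have h2 := Real.neg_pi_div_two_lt_arctan t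
  have h3 := Real.pi_le_four
  rw [abs_le]; constructor <;> linarith

/-- `arctan u + arctan v` has the same sign as `u + v = log r - log s`, hence as `r - s`. -/
lemma arctan_add_arctan_mul_pos {u v r s : ℝ} (hr : 0 < r) (hs : 0 < s)
    (h : u + v = Real.log r - Real.log s) (hne : r ≠ s) :
    0 < (Real.arctan u + Real.arctan v) * (r - s) := by
  rcases lt_or_gt_of_ne hne with hlt | hlt
  · have h1 := Real.log_lt_log hr hlt
    have h2 : Real.arctan u < Real.arctan (-v) := Real.arctan_strictMono (by linarith)
    rw [Real.arctan_neg] at h2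
    exact mul_pos_of_neg_of_neg (by linarith) (by linarith)
  · have h1 := Real.log_lt_log hs hlt
    have h2 : Real.arctan (-v) < Real.arctan u := Real.arctan_strictMono (by linarith)
    rw [Real.arctan_neg] at h2
    exact mul_pos (by linarith) (by linarith)

/-- Coupling densities that are separable up to a common positive factor coincide. -/
theorem ae_eq_of_separable (hZ : IsCouplingDensity μ ν Z) (hZ' : IsCouplingDensity μ ν Z')
    {a a' : X → ℝ} {b b' : Y → ℝ} {K : X × Y → ℝ} (ha : Measurable a) (ha' : Measurable a')
    (hb : Measurable b) (hb' : Measurable b') (ha0 : ∀ x, 0 < a x) (ha0' : ∀ x, 0 < a' x)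
    (hb0 : ∀ y, 0 < b y) (hb0' : ∀ y, 0 < b' y) (hK : ∀ z, 0 < K z)
    (h : ∀ z, Z z = a z.1 * b z.2 * K z) (h' : ∀ z, Z' z = a' z.1 * b' z.2 * K z) :
    Z =ᵐ[μ.prod ν] Z' := by
  -- The log-ratios themselves need not be integrable; `arctan` bounds them and, being odd and
  -- increasing, preserves the sign of their sum.
  set u : X → ℝ := fun x => Real.arctan (Real.log (a x) - Real.log (a' x)) with hu
  set v : Y → ℝ := fun y => Real.arctan (Real.log (b y) - Real.log (b' y)) with hv
  have hum : Measurable u := by fun_prop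
  have hvm : Measurable v := by fun_prop
  have int : ∀ {W : X × Y → ℝ}, IsCouplingDensity μ ν W →
      Integrable (fun z => u z.1 * W z) (μ.prod ν) ∧
      Integrable (fun z => v z.2 * W z) (μ.prod ν) := fun hW =>
    ⟨hW.integrable.bdd_mul (c := 2) (hum.comp measurable_fst).aestronglyMeasurable
      (Eventually.of_forall fun z => abs_arctan_le_two _),
     hW.integrable.bdd_mul (c := 2) (hvm.comp measurable_snd).aestronglyMeasurable
      (Eventually.of_forall fun z => abs_arctan_le_two _)⟩
  set F : X × Y → ℝ := fun z => (u z.1 + v z.2) * (Z z - Z' z) with hF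
  have hFe : F = ((fun z => u z.1 * Z z) + fun z => v z.2 * Z z) -
      ((fun z => u z.1 * Z' z) + fun z => v z.2 * Z' z) := by
    funext z; simp only [hF, Pi.add_apply, Pi.sub_apply]; ring
  obtain ⟨i1, i2⟩ := int hZ
  obtain ⟨i3, i4⟩ := int hZ'
  have hFi : Integrable F (μ.prod ν) := by
    rw [hFe]; exact (i1.add i2).sub (i3.add i4)
  -- Each summand of F involves one coordinate only, and Z and Z' have the same marginals.
  have hF0 : ∫ z, F z ∂(μ.prod ν) = 0 := by
    rw [hFe, integral_sub' (i1.add i2) (i3.add i4), integral_add' i1 i2, integral_add' i3 i4,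
      hZ.integral_comp_fst_mul hum, hZ.integral_comp_snd_mul hvm, hZ'.integral_comp_fst_mul hum,
      hZ'.integral_comp_snd_mul hvm, sub_self]
  have key : ∀ z, Z z ≠ Z' z → 0 < F z := by
    intro z hne
    refine arctan_add_arctan_mul_pos ?_ ?_ ?_ hne
    · rw [h]; exact mul_pos (mul_pos (ha0 _) (hb0 _)) (hK _)
    · rw [h']; exact mul_pos (mul_pos (ha0' _) (hb0' _)) (hK _)
    · rw [h, h', Real.log_mul (mul_pos (ha0 _) (hb0 _)).ne' (hK _).ne',
        Real.log_mul (ha0 _).ne' (hb0 _).ne',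
        Real.log_mul (mul_pos (ha0' _) (hb0' _)).ne' (hK _).ne',
        Real.log_mul (ha0' _).ne' (hb0' _).ne']
      ring
  have hnn : 0 ≤ F := by
    intro z
    by_cases hz : Z z = Z' z
    · simp [hF, hz]
    · exact (key z hz).le
  have h0 := (integral_eq_zero_iff_of_nonneg hnn hFi).1 hF0
  filter_upwards [h0] with z hz
  by_contra hne
  exact (key z hne).ne' hz

/-- The cyclical identity with two points forces the density to be separable up to the factor
`exp (-c / ε)`. -/
lemma IsCyclicallyInvariant.exists_separable {π : Measure (X × Y)}
    (hc : Measurable c) (hπ : IsCyclicallyInvariant c ε μ ν π) :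
    ∃ Z, IsCouplingDensity μ ν Z ∧ π = ofDensity μ ν Z ∧ ∃ (a : X → ℝ) (b : Y → ℝ),
      Measurable a ∧ Measurable b ∧ (∀ x, 0 < a x) ∧ (∀ y, 0 < b y) ∧
      ∀ z, Z z = a z.1 * b z.2 * Real.exp (-(1 / ε) * c z) := by
  obtain ⟨hm, -, -, Z, hZ, h0, rfl, hcyc⟩ := hπ
  obtain ⟨x₀⟩ : Nonempty X := nonempty_of_isProbabilityMeasure μ
  obtain ⟨y₀⟩ : Nonempty Y := nonempty_of_isProbabilityMeasure ν
  refine ⟨Z, isCouplingDensity_of_mem_couplings hZ (fun z => (h0 z).le) hm, rfl,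
    fun x => Z (x, y₀) * Real.exp (1 / ε * c (x, y₀)) /
      (Z (x₀, y₀) * Real.exp (1 / ε * c (x₀, y₀))),
    fun y => Z (x₀, y) * Real.exp (1 / ε * c (x₀, y)), by fun_prop, by fun_prop,
    fun x => ?_, fun y => ?_, fun z => ?_⟩
  · have := h0 (x, y₀); have := h0 (x₀, y₀); positivity
  · have := h0 (x₀, y); positivity
  · obtain ⟨x, y⟩ := z
    have h := hcyc 2 ![x, x₀] ![y, y₀]
    have r0 : finRotate 2 0 = 1 := by decide
    have r1 : finRotate 2 1 = 0 := by decide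
    simp only [Fin.prod_univ_two, Fin.sum_univ_two, r0, r1, Matrix.cons_val_zero,
      Matrix.cons_val_one] at h
    have hne : Z (x₀, y₀) * Real.exp (1 / ε * c (x₀, y₀)) ≠ 0 :=
      (mul_pos (h0 _) (Real.exp_pos _)).ne'
    rw [div_mul_eq_mul_div, div_mul_eq_mul_div, eq_div_iff hne, ← mul_assoc, h]
    have e : Real.exp (-(1 / ε) * ((c (x, y) : ℝ) + c (x₀, y₀) - (c (x, y₀) + c (x₀, y)))) *
        Real.exp (1 / ε * c (x₀, y₀)) = Real.exp (1 / ε * c (x, y₀)) *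
        Real.exp (1 / ε * c (x₀, y)) * Real.exp (-(1 / ε) * c (x, y)) := by
      rw [← Real.exp_add, ← Real.exp_add, ← Real.exp_add]; ring_nf
    linear_combination (Z (x, y₀) * Z (x₀, y)) * e

theorem IsCyclicallyInvariant.eq {π π' : Measure (X × Y)} (hc : Measurable c)
    (hπ : IsCyclicallyInvariant c ε μ ν π) (hπ' : IsCyclicallyInvariant c ε μ ν π') : π = π' := by
  obtain ⟨Z, hZ, rfl, a, b, ha, hb, ha0, hb0, h⟩ := hπ.exists_separable hc
  obtain ⟨Z', hZ', rfl, a', b', ha', hb', ha0', hb0', h'⟩ := hπ'.exists_separable hc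
  exact (hZ.congr_ae hZ'.measurable hZ'.nonneg (ae_eq_of_separable hZ hZ' ha ha' hb hb' ha0 ha0'
    hb0 hb0' (fun z => Real.exp_pos _) h h')).1

end Uniqueness

/-! ### Existence of a minimizer -/

section Existence

variable {μ : Measure X} [IsProbabilityMeasure μ] {ν : Measure Y} [IsProbabilityMeasure ν]
  {c : X × Y → ℝ≥0} {ε : ℝ} {Z Z' : X × Y → ℝ}

lemma IsCouplingDensity.lintegral_eq_one (hZ : IsCouplingDensity μ ν Z) :
    ∫⁻ z, ENNReal.ofReal (Z z) ∂(μ.prod ν) = 1 := by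
  have := hZ.mem_couplings.1.measure_univ
  rwa [ofDensity, withDensity_apply _ MeasurableSet.univ, Measure.restrict_univ] at this

lemma IsCouplingDensity.midpoint (hZ : IsCouplingDensity μ ν Z) (hZ' : IsCouplingDensity μ ν Z') :
    IsCouplingDensity μ ν fun z => (Z z + Z' z) / 2 where
  measurable := (hZ.measurable.add hZ'.measurable).div_const 2
  nonneg z := div_nonneg (add_nonneg (hZ.nonneg z) (hZ'.nonneg z)) zero_le_two
  integrable := (hZ.integrable.add hZ'.integrable).div_const 2
  setIntegral_fst A hA := by
    rw [integral_div, integral_add hZ.integrable.integrableOn hZ'.integrable.integrableOn,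
      hZ.setIntegral_fst A hA, hZ'.setIntegral_fst A hA, add_self_div_two]
  setIntegral_snd B hB := by
    rw [integral_div, integral_add hZ.integrable.integrableOn hZ'.integrable.integrableOn,
      hZ.setIntegral_snd B hB, hZ'.setIntegral_snd B hB, add_self_div_two]

lemma IsCouplingDensity.of_tendsto {W : ℕ → X × Y → ℝ} (hW : ∀ n, IsCouplingDensity μ ν (W n))
    (hm : Measurable Z) (h0 : ∀ z, 0 ≤ Z z) (hi : Integrable Z (μ.prod ν))
    (h : Tendsto (fun n => eLpNorm (W n - Z) 1 (μ.prod ν)) atTop (𝓝 0)) :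
    IsCouplingDensity μ ν Z where
  measurable := hm
  nonneg := h0
  integrable := hi
  setIntegral_fst A hA := by
    refine tendsto_nhds_unique (tendsto_setIntegral_of_L1' Z hi.1
      (Eventually.of_forall fun n => (hW n).integrable) h _) ?_
    simp_rw [(hW _).setIntegral_fst A hA]
    exact tendsto_const_nhds
  setIntegral_snd B hB := by
    refine tendsto_nhds_unique (tendsto_setIntegral_of_L1' Z hi.1
      (Eventually.of_forall fun n => (hW n).integrable) h _) ?_
    simp_rw [(hW _).setIntegral_snd B hB]
    exact tendsto_const_nhds

lemma two_mul_entropicIntegrand_midpoint_add_le (hε : 0 ≤ ε) {r s : ℝ} (hr : 0 ≤ r) (hs : 0 ≤ s)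
    (z : X × Y) :
    2 * entropicIntegrand c ε z ((r + s) / 2) + ε * ((√r - √s) ^ 2 / 2) ≤
      entropicIntegrand c ε z r + entropicIntegrand c ε z s := by
  have := mul_le_mul_of_nonneg_left (klFun_midpoint hr hs) hε
  simp only [entropicIntegrand]
  linarith

/-- Near-minimizers of the entropic cost are close in `L¹`. -/
lemma lintegral_abs_sub_le (hc : Measurable c) (hε : 0 < ε) {α : ℝ≥0∞} (hα : α ≠ ∞)
    (hmin : ∀ π ∈ couplings μ ν, α ≤ entropicCost c ε μ ν π)
    (hZ : IsCouplingDensity μ ν Z) (hZ' : IsCouplingDensity μ ν Z') {l : ℝ} (hl : 0 < l)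
    (h : entropicCost c ε μ ν (ofDensity μ ν Z) ≤ α + ENNReal.ofReal (ε * l ^ 2))
    (h' : entropicCost c ε μ ν (ofDensity μ ν Z') ≤ α + ENNReal.ofReal (ε * l ^ 2)) :
    ∫⁻ z, ENNReal.ofReal |Z z - Z' z| ∂(μ.prod ν) ≤ ENNReal.ofReal (4 * l) := by
  have hm := hZ.measurable
  have hm' := hZ'.measurable
  have hmid := hmin _ (hZ.midpoint hZ').mem_couplings
  rw [entropicCost_ofDensity hc hε.le hZ] at h
  rw [entropicCost_ofDensity hc hε.le hZ'] at h'
  rw [entropicCost_ofDensity hc hε.le (hZ.midpoint hZ')] at hmid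
  set E := ∫⁻ z, ENNReal.ofReal (ε * ((√(Z z) - √(Z' z)) ^ 2 / 2)) ∂(μ.prod ν) with hE
  -- The midpoint is again a coupling, hence costs at least α; the finite term 2α then cancels and
  -- leaves a bound on the Hellinger term E.
  have hsum : 2 * α + E ≤ 2 * α + 2 * ENNReal.ofReal (ε * l ^ 2) := by
    calc 2 * α + E ≤ 2 * (∫⁻ z, ENNReal.ofReal
          (entropicIntegrand c ε z ((Z z + Z' z) / 2)) ∂(μ.prod ν)) + E := by gcongr
      _ = ∫⁻ z, (2 * ENNReal.ofReal (entropicIntegrand c ε z ((Z z + Z' z) / 2)) +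
          ENNReal.ofReal (ε * ((√(Z z) - √(Z' z)) ^ 2 / 2))) ∂(μ.prod ν) := by
        have := (measurable_entropicIntegrand (ε := ε) hc (hZ.midpoint hZ').measurable)
        rw [lintegral_add_left (this.ennreal_ofReal.const_mul 2),
          lintegral_const_mul _ this.ennreal_ofReal]
      _ ≤ ∫⁻ z, (ENNReal.ofReal (entropicIntegrand c ε z (Z z)) +
          ENNReal.ofReal (entropicIntegrand c ε z (Z' z))) ∂(μ.prod ν) := by
        refine lintegral_mono fun z => ?_
        have hz := hZ.nonneg z
        have hz' := hZ'.nonneg z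
        have n0 : 0 ≤ entropicIntegrand c ε z ((Z z + Z' z) / 2) :=
          entropicIntegrand_nonneg hε.le (by positivity) z
        have e2 : (2 : ℝ≥0∞) = ENNReal.ofReal 2 := by simp
        simp only
        rw [e2, ← ENNReal.ofReal_mul zero_le_two, ← ENNReal.ofReal_add (by positivity)
          (by positivity), ← ENNReal.ofReal_add (entropicIntegrand_nonneg hε.le hz z)
          (entropicIntegrand_nonneg hε.le hz' z)]
        exact ENNReal.ofReal_le_ofReal
          (two_mul_entropicIntegrand_midpoint_add_le hε.le hz hz' z)
      _ = _ + _ := lintegral_add_left (measurable_entropicIntegrand hc hm).ennreal_ofReal _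
      _ ≤ (α + ENNReal.ofReal (ε * l ^ 2)) + (α + ENNReal.ofReal (ε * l ^ 2)) := add_le_add h h'
      _ = _ := by ring
  have hE2 : E ≤ 2 * ENNReal.ofReal (ε * l ^ 2) :=
    (ENNReal.add_le_add_iff_left (ENNReal.mul_ne_top (by simp) hα)).1 hsum
  -- The Hellinger part contributes 2l, and the two unit masses weighted by l another 2l.
  calc ∫⁻ z, ENNReal.ofReal |Z z - Z' z| ∂(μ.prod ν)
      ≤ ∫⁻ z, (ENNReal.ofReal (1 / (ε * l)) * ENNReal.ofReal (ε * ((√(Z z) - √(Z' z)) ^ 2 / 2)) +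
          ENNReal.ofReal l * (ENNReal.ofReal (Z z) + ENNReal.ofReal (Z' z))) ∂(μ.prod ν) := by
        refine lintegral_mono fun z => ?_
        have hz := hZ.nonneg z
        have hz' := hZ'.nonneg z
        simp only
        rw [← ENNReal.ofReal_add hz hz', ← ENNReal.ofReal_mul hl.le,
          ← ENNReal.ofReal_mul (by positivity), ← ENNReal.ofReal_add (by positivity)
          (by positivity)]
        refine ENNReal.ofReal_le_ofReal ((abs_sub_le_sq_sqrt_sub_sqrt hz hz' hl).trans_eq ?_)
        field_simp
    _ = ENNReal.ofReal (1 / (ε * l)) * E + ENNReal.ofReal l * (1 + 1) := by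
        rw [lintegral_add_left (by fun_prop), lintegral_const_mul _ (by fun_prop),
          lintegral_const_mul _ (by fun_prop), lintegral_add_left (by fun_prop),
          hZ.lintegral_eq_one, hZ'.lintegral_eq_one]
    _ ≤ ENNReal.ofReal (1 / (ε * l)) * (2 * ENNReal.ofReal (ε * l ^ 2)) +
          ENNReal.ofReal l * (1 + 1) := by gcongr
    _ = ENNReal.ofReal (4 * l) := by
        have e2 : (2 : ℝ≥0∞) = ENNReal.ofReal 2 := by simp
        rw [one_add_one_eq_two, e2, ← ENNReal.ofReal_mul zero_le_two,
          ← ENNReal.ofReal_mul (by positivity), ← ENNReal.ofReal_mul hl.le,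
          ← ENNReal.ofReal_add (by positivity) (by positivity)]
        congr 1
        field_simp
        ring

/-- Uniform convexity replaces weak compactness: near-minimizers are close in L¹, so completeness of
L¹ yields the limit. -/
theorem exists_isEntropicOptimal (hc : Measurable c) (hε : 0 < ε)
    (hfin : ∃ π ∈ couplings μ ν, entropicCost c ε μ ν π ≠ ∞) :
    ∃ π, IsEntropicOptimal c ε μ ν π := by
  set α := ⨅ π ∈ couplings μ ν, entropicCost c ε μ ν π with hα
  have hmin : ∀ π ∈ couplings μ ν, α ≤ entropicCost c ε μ ν π := fun π hπ => iInf₂_le π hπ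
  have hαtop : α ≠ ∞ := by
    obtain ⟨π, hπ, h⟩ := hfin
    exact ((hmin π hπ).trans_lt (lt_top_iff_ne_top.2 h)).ne
  -- The factor 1/8 makes the L¹ distance 4 l n at most half of 2⁻ⁿ, hence strictly below this
  -- summable bound.
  set l : ℕ → ℝ := fun n => (1 / 2) ^ n / 8 with hl
  have hl0 : ∀ n, 0 < l n := fun n => by positivity
  have hlanti : Antitone l := fun m n hmn => by
    simp only [hl]
    have := pow_le_pow_of_le_one (by norm_num : (0 : ℝ) ≤ 1 / 2) (by norm_num) hmn
    linarith
  have hseq : ∀ n, ∃ Z, IsCouplingDensity μ ν Z ∧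
      entropicCost c ε μ ν (ofDensity μ ν Z) ≤ α + ENNReal.ofReal (ε * l n ^ 2) := by
    intro n
    have hpos : 0 < ENNReal.ofReal (ε * l n ^ 2) := by
      have := hl0 n
      rw [ENNReal.ofReal_pos]; positivity
    have hlt : α < α + ENNReal.ofReal (ε * l n ^ 2) := ENNReal.lt_add_right hαtop hpos.ne'
    obtain ⟨π, hπ⟩ := iInf_lt_iff.1 (hα ▸ hlt)
    obtain ⟨hmem, hπ⟩ := iInf_lt_iff.1 hπ
    obtain ⟨Z, hZ, rfl⟩ := exists_eq_ofDensity hmem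
      (absolutelyContinuous_of_entropicCost_ne_top hε (hπ.trans_le le_top).ne)
    exact ⟨Z, hZ, hπ.le⟩
  choose W hW hcost using hseq
  have hcauchy : ∀ N n m : ℕ, N ≤ n → N ≤ m →
      eLpNorm (W n - W m) 1 (μ.prod ν) < ENNReal.ofReal ((1 / 2) ^ N) := by
    intro N n m hn hm
    have bound : ∀ k, N ≤ k → entropicCost c ε μ ν (ofDensity μ ν (W k)) ≤
        α + ENNReal.ofReal (ε * l N ^ 2) := by
      intro k hk
      refine (hcost k).trans ?_
      have h1 := hlanti hk
      have h2 := (hl0 k).le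
      gcongr
    have h := lintegral_abs_sub_le hc hε hαtop hmin (hW n) (hW m) (hl0 N) (bound n hn) (bound m hm)
    rw [eLpNorm_one_eq_lintegral_enorm]
    simp_rw [Real.enorm_eq_ofReal_abs, Pi.sub_apply]
    refine h.trans_lt ((ENNReal.ofReal_lt_ofReal_iff (by positivity)).2 ?_)
    have : (0 : ℝ) < (1 / 2) ^ N := by positivity
    simp only [hl]
    linarith
  obtain ⟨f, hf, hlim⟩ := Lp.cauchy_complete_eLpNorm le_rfl
    (fun n => memLp_one_iff_integrable.2 (hW n).integrable)
    (summable_geometric_of_lt_one (by norm_num : (0 : ℝ) ≤ 1 / 2) (by norm_num)).tsum_ofReal_ne_top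
    hcauchy
  obtain ⟨ns, hns, hae⟩ := (tendstoInMeasure_of_tendsto_eLpNorm one_ne_zero
    (fun n => (hW n).integrable.1) hf.1 hlim).exists_seq_tendsto_ae
  obtain ⟨g, hg, hfg⟩ := hf.1
  -- The limit is nonnegative only almost everywhere; its positive part is a version that is
  -- nonnegative everywhere.
  set Z : X × Y → ℝ := fun z => max (g z) 0 with hZdef
  have hZm : Measurable Z := hg.measurable.max measurable_const
  have hfZ : f =ᵐ[μ.prod ν] Z := by
    filter_upwards [hfg, hae] with z hz hz'
    have : 0 ≤ f z := ge_of_tendsto' hz' fun n => (hW _).nonneg z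
    simp only [hZdef, ← hz, max_eq_left this]
  have hZ : IsCouplingDensity μ ν Z := by
    refine IsCouplingDensity.of_tendsto hW hZm (fun z => le_max_right _ _)
      ((memLp_one_iff_integrable.1 hf).congr hfZ) (hlim.congr fun n => eLpNorm_congr_ae ?_)
    filter_upwards [hfZ] with z hz
    simp only [Pi.sub_apply, hz]
  refine ⟨ofDensity μ ν Z, hZ.mem_couplings, ?_⟩
  suffices h : entropicCost c ε μ ν (ofDensity μ ν Z) ≤ α from
    fun π hπ => h.trans (hmin π hπ)
  have hlim0 : Tendsto (fun k => α + ENNReal.ofReal (ε * l (ns k) ^ 2)) atTop (𝓝 α) := by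
    have h1 : Tendsto l atTop (𝓝 0) := by
      have := (tendsto_pow_atTop_nhds_zero_of_lt_one (by norm_num : (0 : ℝ) ≤ 1 / 2)
        (by norm_num)).div_const 8
      rwa [zero_div] at this
    have h2 := ((h1.comp hns.tendsto_atTop).pow 2).const_mul ε
    have h3 := (ENNReal.tendsto_ofReal h2).const_add α
    simpa using h3
  rw [entropicCost_ofDensity hc hε.le hZ]
  calc ∫⁻ z, ENNReal.ofReal (entropicIntegrand c ε z (Z z)) ∂(μ.prod ν)
      = ∫⁻ z, liminf (fun k => ENNReal.ofReal (entropicIntegrand c ε z (W (ns k) z))) atTop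
          ∂(μ.prod ν) := by
        refine lintegral_congr_ae ?_
        filter_upwards [hfZ, hae] with z hz hz'
        rw [hz] at hz'
        have hcont : Continuous (entropicIntegrand c ε z) := by
          have := continuous_klFun
          unfold entropicIntegrand
          fun_prop
        exact (ENNReal.tendsto_ofReal ((hcont.tendsto _).comp hz')).liminf_eq.symm
    -- Fatou's lemma along the almost everywhere convergent subsequence.
    _ ≤ liminf (fun k => ∫⁻ z, ENNReal.ofReal (entropicIntegrand c ε z (W (ns k) z))
          ∂(μ.prod ν)) atTop :=
        lintegral_liminf_le fun k =>
          (measurable_entropicIntegrand hc (hW _).measurable).ennreal_ofReal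
    _ ≤ liminf (fun k => α + ENNReal.ofReal (ε * l (ns k) ^ 2)) atTop := by
        refine liminf_le_liminf (Eventually.of_forall fun k => ?_)
        rw [← entropicCost_ofDensity hc hε.le (hW _)]
        exact hcost _
    _ = α := hlim0.liminf_eq

end Existence

/-! ### Perturbations that exchange second coordinates -/

section Exchange

/-- Exchange the second coordinates of a pair of points of `X × Y`. -/
def exchange {X Y : Type*} (w : (X × Y) × (X × Y)) : (X × Y) × (X × Y) :=
  ((w.1.1, w.2.2), (w.2.1, w.1.2))

@[simp] lemma exchange_exchange {X Y : Type*} (w : (X × Y) × (X × Y)) :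
    exchange (exchange w) = w := rfl

lemma measurable_exchange : Measurable (exchange : (X × Y) × (X × Y) → _) := by
  unfold exchange
  fun_prop

lemma measurableEmbedding_exchange : MeasurableEmbedding (exchange : (X × Y) × (X × Y) → _) :=
  (MeasurableEquiv.ofInvolutive exchange exchange_exchange measurable_exchange).measurableEmbedding

lemma measurableEmbedding_swap {α : Type*} [MeasurableSpace α] :
    MeasurableEmbedding (Prod.swap : α × α → α × α) :=
  (MeasurableEquiv.prodComm (α := α) (β := α)).measurableEmbedding

variable (μ : Measure X) [IsProbabilityMeasure μ] (ν : Measure Y) [IsProbabilityMeasure ν]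

/-- The four coordinates are independent and `exchange` permutes the two with law ν. -/
lemma measurePreserving_exchange :
    MeasurePreserving exchange ((μ.prod ν).prod (μ.prod ν)) ((μ.prod ν).prod (μ.prod ν)) := by
  have a1 := measurePreserving_prodAssoc μ ν (μ.prod ν)
  have a2 := measurePreserving_prodAssoc μ ν ν
  have s1 : MeasurePreserving Prod.swap (ν.prod (μ.prod ν)) ((μ.prod ν).prod ν) :=
    Measure.measurePreserving_swap
  have s2 : MeasurePreserving Prod.swap ((μ.prod ν).prod ν) (ν.prod (μ.prod ν)) :=
    Measure.measurePreserving_swap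
  have s3 : MeasurePreserving Prod.swap (ν.prod ν) (ν.prod ν) := Measure.measurePreserving_swap
  have r := s2.comp ((a2.symm _).comp (((MeasurePreserving.id μ).prod s3).comp (a2.comp s1)))
  exact (a1.symm _).comp (((MeasurePreserving.id μ).prod r).comp a1)

/-- The change of density on `X × Y` obtained by moving mass from `exchange w` to `w`, uniformly
over `w ∈ S`. -/
noncomputable def exchangeDensity (S : Set ((X × Y) × (X × Y))) (z : X × Y) : ℝ :=
  (μ.prod ν).real (Prod.mk z ⁻¹' S) - (μ.prod ν).real (Prod.mk z ⁻¹' (exchange ⁻¹' S))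

variable {S : Set ((X × Y) × (X × Y))}

lemma measurable_measureReal_section (hS : MeasurableSet S) :
    Measurable fun z => (μ.prod ν).real (Prod.mk z ⁻¹' S) :=
  (measurable_measure_prodMk_left hS).ennreal_toReal

lemma measurable_exchangeDensity (hS : MeasurableSet S) : Measurable (exchangeDensity μ ν S) :=
  (measurable_measureReal_section μ ν hS).sub
    (measurable_measureReal_section μ ν (measurable_exchange hS))

lemma abs_exchangeDensity_le_one (z : X × Y) : |exchangeDensity μ ν S z| ≤ 1 := by
  rw [exchangeDensity, abs_le]
  have h1 := measureReal_nonneg (μ := μ.prod ν) (s := Prod.mk z ⁻¹' S)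
  have h2 := measureReal_nonneg (μ := μ.prod ν) (s := Prod.mk z ⁻¹' (exchange ⁻¹' S))
  have h3 := measureReal_le_one (μ := μ.prod ν) (s := Prod.mk z ⁻¹' S)
  have h4 := measureReal_le_one (μ := μ.prod ν) (s := Prod.mk z ⁻¹' (exchange ⁻¹' S))
  constructor <;> linarith

variable {μ ν}

lemma integrable_of_abs_le {α : Type*} [MeasurableSpace α] {P : Measure α} [IsFiniteMeasure P]
    {f : α → ℝ} (hf : Measurable f) {C : ℝ} (hC : ∀ a, |f a| ≤ C) : Integrable f P :=
  Integrable.of_bound hf.aestronglyMeasurable C (Eventually.of_forall hC)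

lemma integral_mul_measureReal_section (hS : MeasurableSet S) {f : X × Y → ℝ} (hf : Measurable f)
    {C : ℝ} (hC : ∀ z, |f z| ≤ C) :
    ∫ z, f z * (μ.prod ν).real (Prod.mk z ⁻¹' S) ∂(μ.prod ν) =
      ∫ w in S, f w.1 ∂((μ.prod ν).prod (μ.prod ν)) := by
  have hi : Integrable (fun w : (X × Y) × (X × Y) => f w.1) ((μ.prod ν).prod (μ.prod ν)) :=
    integrable_of_abs_le (hf.comp measurable_fst) fun w => hC _
  rw [← integral_indicator hS, integral_prod _ (hi.indicator hS)]
  refine integral_congr_ae (Eventually.of_forall fun z => ?_)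
  have e : (fun z' => S.indicator (fun w : (X × Y) × (X × Y) => f w.1) (z, z')) =
      (Prod.mk z ⁻¹' S).indicator fun _ => f z := rfl
  simp only
  rw [e, integral_indicator (measurable_prodMk_left hS), setIntegral_const, smul_eq_mul, mul_comm]

lemma integral_mul_exchangeDensity (hS : MeasurableSet S) {f : X × Y → ℝ} (hf : Measurable f)
    {C : ℝ} (hC : ∀ z, |f z| ≤ C) :
    ∫ z, f z * exchangeDensity μ ν S z ∂(μ.prod ν) =
      ∫ w in S, (f w.1 - f (exchange w).1) ∂((μ.prod ν).prod (μ.prod ν)) := by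
  have hS' := measurable_exchange hS
  have int : ∀ {R : Set ((X × Y) × (X × Y))}, MeasurableSet R →
      Integrable (fun z => f z * (μ.prod ν).real (Prod.mk z ⁻¹' R)) (μ.prod ν) := by
    intro R hR
    refine integrable_of_abs_le (C := C) (hf.mul (measurable_measureReal_section μ ν hR))
      fun z => ?_
    rw [abs_mul, abs_of_nonneg measureReal_nonneg]
    exact (mul_le_of_le_one_right (abs_nonneg _) measureReal_le_one).trans (hC z)
  have hi1 : Integrable (fun w : (X × Y) × (X × Y) => f w.1) ((μ.prod ν).prod (μ.prod ν)) :=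
    integrable_of_abs_le (hf.comp measurable_fst) fun w => hC _
  have hi2 : Integrable (fun w : (X × Y) × (X × Y) => f (exchange w).1)
      ((μ.prod ν).prod (μ.prod ν)) :=
    integrable_of_abs_le (hf.comp (measurable_fst.comp measurable_exchange)) fun w => hC _
  simp_rw [exchangeDensity, mul_sub]
  rw [integral_sub (int hS) (int hS'), integral_sub hi1.integrableOn hi2.integrableOn,
    integral_mul_measureReal_section hS hf hC, integral_mul_measureReal_section hS' hf hC]
  congr 1
  exact (measurePreserving_exchange μ ν).setIntegral_preimage_emb measurableEmbedding_exchange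
    (fun w => f (exchange w).1) S

lemma setIntegral_swap {g : (X × Y) × (X × Y) → ℝ} (hS : Prod.swap ⁻¹' S = S) :
    ∫ w in S, g w.swap ∂((μ.prod ν).prod (μ.prod ν)) =
      ∫ w in S, g w ∂((μ.prod ν).prod (μ.prod ν)) := by
  have h : MeasurePreserving Prod.swap ((μ.prod ν).prod (μ.prod ν))
    ((μ.prod ν).prod (μ.prod ν)) := Measure.measurePreserving_swap
  conv_lhs => rw [← hS]
  exact h.setIntegral_preimage_emb measurableEmbedding_swap g S

/-- Average the integral over S with its image under swapping the two points, which leaves S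
invariant. -/
lemma two_mul_integral_mul_exchangeDensity (hS : MeasurableSet S) (hsw : Prod.swap ⁻¹' S = S)
    {f : X × Y → ℝ} (hf : Measurable f) {C : ℝ} (hC : ∀ z, |f z| ≤ C) :
    2 * ∫ z, f z * exchangeDensity μ ν S z ∂(μ.prod ν) =
      ∫ w in S, (f w.1 + f w.2 - f (exchange w).1 - f (exchange w).2)
        ∂((μ.prod ν).prod (μ.prod ν)) := by
  have hi : ∀ {g : (X × Y) × (X × Y) → X × Y}, Measurable g →
      Integrable (fun w => f (g w)) (((μ.prod ν).prod (μ.prod ν)).restrict S) := fun hg =>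
    (integrable_of_abs_le (hf.comp hg) fun w => hC _)
  have h1 := hi measurable_fst
  have h2 := hi measurable_snd
  have h3 := hi (measurable_fst.comp measurable_exchange)
  have h4 := hi (measurable_snd.comp measurable_exchange)
  have e := setIntegral_swap (μ := μ) (ν := ν) (g := fun w => f w.1 - f (exchange w).1) hsw
  rw [integral_mul_exchangeDensity hS hf hC, two_mul]
  nth_rewrite 1 [← e]
  rw [← integral_add]
  · refine integral_congr_ae (Eventually.of_forall fun w => ?_)
    simp only [exchange, Prod.fst_swap, Prod.snd_swap]
    ring
  · exact h2.sub h4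
  · exact h1.sub h3

/-- The first point keeps its first coordinate under `exchange`, so no symmetry of S is needed here.
-/
lemma setIntegral_fst_exchangeDensity (hS : MeasurableSet S) {A : Set X} (hA : MeasurableSet A) :
    ∫ z in Prod.fst ⁻¹' A, exchangeDensity μ ν S z ∂(μ.prod ν) = 0 := by
  have hm : Measurable ((Prod.fst ⁻¹' A : Set (X × Y)).indicator fun _ => (1 : ℝ)) :=
    measurable_const.indicator (measurable_fst hA)
  have h := integral_mul_exchangeDensity (μ := μ) (ν := ν) hS hm (C := 1) fun z => by
    by_cases hz : z ∈ (Prod.fst ⁻¹' A : Set (X × Y)) <;> simp [hz]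
  rw [← integral_indicator (measurable_fst hA)]
  have e : ∀ w : (X × Y) × (X × Y), (Prod.fst ⁻¹' A : Set (X × Y)).indicator (fun _ => (1 : ℝ)) w.1 -
      (Prod.fst ⁻¹' A : Set (X × Y)).indicator (fun _ => (1 : ℝ)) (exchange w).1 = 0 :=
    fun w => sub_self _
  simp_rw [e, integral_zero] at h
  rw [← h]
  refine integral_congr_ae (Eventually.of_forall fun z => ?_)
  by_cases hz : z ∈ (Prod.fst ⁻¹' A : Set (X × Y)) <;> simp [hz]

/-- The second coordinates are only permuted within the pair, so the cancellation shows up after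
symmetrization. -/
lemma setIntegral_snd_exchangeDensity (hS : MeasurableSet S) (hsw : Prod.swap ⁻¹' S = S)
    {B : Set Y} (hB : MeasurableSet B) :
    ∫ z in Prod.snd ⁻¹' B, exchangeDensity μ ν S z ∂(μ.prod ν) = 0 := by
  have hm : Measurable ((Prod.snd ⁻¹' B : Set (X × Y)).indicator fun _ => (1 : ℝ)) :=
    measurable_const.indicator (measurable_snd hB)
  have h := two_mul_integral_mul_exchangeDensity (μ := μ) (ν := ν) hS hsw hm (C := 1) fun z => by
    by_cases hz : z ∈ (Prod.snd ⁻¹' B : Set (X × Y)) <;> simp [hz]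
  rw [← integral_indicator (measurable_snd hB)]
  have e : ∀ w : (X × Y) × (X × Y), (Prod.snd ⁻¹' B : Set (X × Y)).indicator (fun _ => (1 : ℝ)) w.1 +
      (Prod.snd ⁻¹' B : Set (X × Y)).indicator (fun _ => (1 : ℝ)) w.2 -
      (Prod.snd ⁻¹' B : Set (X × Y)).indicator (fun _ => (1 : ℝ)) (exchange w).1 -
      (Prod.snd ⁻¹' B : Set (X × Y)).indicator (fun _ => (1 : ℝ)) (exchange w).2 = 0 := by
    intro w
    rw [sub_sub, add_comm]
    exact sub_self _
  simp_rw [e, integral_zero] at h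
  rw [← (mul_eq_zero.1 h).resolve_left two_ne_zero]
  refine integral_congr_ae (Eventually.of_forall fun z => ?_)
  by_cases hz : z ∈ (Prod.snd ⁻¹' B : Set (X × Y)) <;> simp [hz]

lemma IsCouplingDensity.add_exchangeDensity {Z : X × Y → ℝ} (hZ : IsCouplingDensity μ ν Z)
    (hS : MeasurableSet S) (hsw : Prod.swap ⁻¹' S = S) {t : ℝ}
    (h0 : ∀ z, 0 ≤ Z z + t * exchangeDensity μ ν S z) :
    IsCouplingDensity μ ν fun z => Z z + t * exchangeDensity μ ν S z := by
  have hm := measurable_exchangeDensity μ ν hS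
  have hi : Integrable (fun z => t * exchangeDensity μ ν S z) (μ.prod ν) :=
    (integrable_of_abs_le hm (abs_exchangeDensity_le_one μ ν)).const_mul t
  refine ⟨hZ.measurable.add (hm.const_mul t), h0, hZ.integrable.add hi, fun A hA => ?_,
    fun B hB => ?_⟩
  · rw [integral_add hZ.integrable.integrableOn hi.integrableOn, hZ.setIntegral_fst A hA,
      integral_const_mul, setIntegral_fst_exchangeDensity hS hA, mul_zero, add_zero]
  · rw [integral_add hZ.integrable.integrableOn hi.integrableOn, hZ.setIntegral_snd B hB,
      integral_const_mul, setIntegral_snd_exchangeDensity hS hsw hB, mul_zero, add_zero]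

end Exchange

/-! ### First-order condition at a minimizer -/

section FirstOrder

/-- A step of size at most s/2 stays in a region where the slope of log is at most 2N, which bounds
the error by 2Nt. -/
lemma mul_log_add_mul_le {s N d t : ℝ} (hN : 0 < N) (hs : 1 / N ≤ s) (hd : |d| ≤ 1) (ht : 0 < t)
    (htN : t ≤ 1 / (2 * N)) :
    s / 2 ≤ s + t * d ∧ d * Real.log (s + t * d) ≤ d * Real.log s + 2 * N * t := by
  have hN' : (0 : ℝ) < 1 / N := by positivity
  have hs0 : 0 < s := hN'.trans_le hs
  have hd' := abs_le.1 hd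
  have htN2 : t ≤ s / 2 := by
    refine htN.trans ?_
    have : 1 / (2 * N) = 1 / N / 2 := by field_simp
    linarith
  have h1 : s / 2 ≤ s + t * d := by nlinarith
  have hr0 : 0 < s + t * d := by linarith
  refine ⟨h1, ?_⟩
  have hNs : 1 ≤ N * s := by
    rw [div_le_iff₀ hN] at hs; linarith
  have hd2 : d ^ 2 ≤ 1 := by nlinarith
  rcases le_total 0 d with h0 | h0
  · have hl := Real.log_le_sub_one_of_pos (div_pos hr0 hs0)
    rw [Real.log_div hr0.ne' hs0.ne'] at hl
    have h2 := mul_le_mul_of_nonneg_left hl h0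
    have h3 : d * ((s + t * d) / s - 1) = t * d ^ 2 / s := by field_simp; ring
    have h4 : t * d ^ 2 / s ≤ 2 * N * t := by
      rw [div_le_iff₀ hs0]
      nlinarith [mul_le_mul_of_nonneg_left hd2 ht.le, mul_le_mul_of_nonneg_left hNs ht.le]
    linarith
  · have hl := Real.log_le_sub_one_of_pos (div_pos hs0 hr0)
    rw [Real.log_div hs0.ne' hr0.ne'] at hl
    have h2 := mul_le_mul_of_nonneg_left hl (neg_nonneg.2 h0)
    have h3 : -d * (s / (s + t * d) - 1) = t * d ^ 2 / (s + t * d) := by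
      rw [div_sub_one hr0.ne']; ring
    have h4 : t * d ^ 2 / (s + t * d) ≤ 2 * N * t := by
      rw [div_le_iff₀ hr0]
      have : 1 ≤ 2 * N * (s + t * d) := by nlinarith
      nlinarith [mul_le_mul_of_nonneg_left hd2 ht.le, mul_le_mul_of_nonneg_left this ht.le]
    linarith

/-- The points at which the cost is at most `N` and the density `Z` is either zero or in
`[1 / N, N]`. -/
def boundedPart (c : X × Y → ℝ≥0) (Z : X × Y → ℝ) (N : ℝ) : Set (X × Y) :=
  {z | (Z z = 0 ∨ 1 / N ≤ Z z) ∧ Z z ≤ N ∧ (c z : ℝ) ≤ N}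

/-- The density `Z` with the factor `exp (-c / ε)` removed. -/
noncomputable def tilt (c : X × Y → ℝ≥0) (ε : ℝ) (Z : X × Y → ℝ) (z : X × Y) : ℝ :=
  Z z * Real.exp (1 / ε * c z)

/-- The pairs of points of `boundedPart c Z N` at which an exchange of second coordinates strictly
increases the product of the tilted densities. -/
def exchangeSet (c : X × Y → ℝ≥0) (ε : ℝ) (Z : X × Y → ℝ) (N : ℝ) : Set ((X × Y) × (X × Y)) :=
  {w | (w.1 ∈ boundedPart c Z N ∧ w.2 ∈ boundedPart c Z N) ∧
    ((exchange w).1 ∈ boundedPart c Z N ∧ (exchange w).2 ∈ boundedPart c Z N) ∧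
    tilt c ε Z w.1 * tilt c ε Z w.2 < tilt c ε Z (exchange w).1 * tilt c ε Z (exchange w).2}

open Classical in
/-- The logarithm of `tilt c ε Z` on `boundedPart c Z N`, with `log 0` replaced by `-M`. -/
noncomputable def truncLogTilt (c : X × Y → ℝ≥0) (ε : ℝ) (Z : X × Y → ℝ) (N M : ℝ) (z : X × Y) : ℝ :=
  if z ∈ boundedPart c Z N then (if Z z = 0 then -M else Real.log (Z z)) + 1 / ε * c z else 0

variable {c : X × Y → ℝ≥0} {ε : ℝ} {Z : X × Y → ℝ} {N M : ℝ}

lemma measurable_tilt (hc : Measurable c) (hZ : Measurable Z) : Measurable (tilt c ε Z) := by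
  unfold tilt
  fun_prop

lemma measurableSet_boundedPart (hc : Measurable c) (hZ : Measurable Z) :
    MeasurableSet (boundedPart c Z N) := by
  have hc' : Measurable fun z => (c z : ℝ) := by fun_prop
  exact ((hZ (measurableSet_singleton 0)).union (measurableSet_le measurable_const hZ)).inter
    ((measurableSet_le hZ measurable_const).inter (measurableSet_le hc' measurable_const))

lemma measurableSet_exchangeSet (hc : Measurable c) (hZ : Measurable Z) :
    MeasurableSet (exchangeSet c ε Z N) := by
  have hD := measurableSet_boundedPart (N := N) hc hZ
  have hW := measurable_tilt (ε := ε) hc hZ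
  have e1 := measurable_fst.comp (measurable_exchange (X := X) (Y := Y))
  have e2 := measurable_snd.comp (measurable_exchange (X := X) (Y := Y))
  exact ((measurable_fst hD).inter (measurable_snd hD)).inter
    (((e1 hD).inter (e2 hD)).inter
      (measurableSet_lt ((hW.comp measurable_fst).mul (hW.comp measurable_snd))
        ((hW.comp e1).mul (hW.comp e2))))

lemma swap_preimage_exchangeSet :
    Prod.swap ⁻¹' exchangeSet c ε Z N = exchangeSet c ε Z N := by
  ext w
  simp only [exchangeSet, exchange, Set.mem_preimage, Set.mem_ofPred_eq, Prod.fst_swap,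
    Prod.snd_swap]
  rw [mul_comm (tilt c ε Z w.2), mul_comm (tilt c ε Z (w.2.1, w.1.2)),
    and_comm (a := w.2 ∈ boundedPart c Z N), and_comm (a := (w.2.1, w.1.2) ∈ boundedPart c Z N)]

lemma measurable_truncLogTilt (hc : Measurable c) (hZ : Measurable Z) :
    Measurable (truncLogTilt c ε Z N M) := by
  classical
  refine Measurable.ite (measurableSet_boundedPart hc hZ) (Measurable.add ?_ (by fun_prop))
    measurable_const
  exact Measurable.ite (hZ (measurableSet_singleton 0)) measurable_const (by fun_prop)

lemma truncLogTilt_of_ne {z : X × Y} (hz : z ∈ boundedPart c Z N) (h : Z z ≠ 0) :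
    truncLogTilt c ε Z N M z = Real.log (Z z) + 1 / ε * c z := by
  rw [truncLogTilt, if_pos hz, if_neg h]

lemma truncLogTilt_of_eq {z : X × Y} (hz : z ∈ boundedPart c Z N) (h : Z z = 0) :
    truncLogTilt c ε Z N M z = -M + 1 / ε * c z := by
  rw [truncLogTilt, if_pos hz, if_pos h]

lemma abs_log_le_of_mem_boundedPart (hN : 1 ≤ N) {z : X × Y} (hz : z ∈ boundedPart c Z N)
    (h : Z z ≠ 0) : 0 < Z z ∧ |Real.log (Z z)| ≤ Real.log N := by
  have hN0 : 0 < N := by linarith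
  have h1 := hz.1.resolve_left h
  have h0 : 0 < Z z := (show 0 < 1 / N by positivity).trans_le h1
  refine ⟨h0, abs_le.2 ⟨?_, Real.log_le_log h0 hz.2.1⟩⟩
  have := Real.log_le_log (by positivity) h1
  rwa [one_div, Real.log_inv] at this

lemma abs_truncLogTilt_le (hε : 0 < ε) (hN : 1 ≤ N) (z : X × Y) :
    |truncLogTilt c ε Z N M z| ≤ |M| + Real.log N + 1 / ε * N := by
  have hl := Real.log_nonneg hN
  have hN0 : 0 < N := by linarith
  have he : 0 < 1 / ε := by positivity
  by_cases hz : z ∈ boundedPart c Z N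
  · have hc0 : 0 ≤ 1 / ε * (c z : ℝ) := by positivity
    have hc1 : 1 / ε * (c z : ℝ) ≤ 1 / ε * N := mul_le_mul_of_nonneg_left hz.2.2 he.le
    by_cases h : Z z = 0
    · rw [truncLogTilt_of_eq hz h]
      refine (abs_add_le _ _).trans ?_
      rw [abs_neg, abs_of_nonneg hc0]
      linarith
    · rw [truncLogTilt_of_ne hz h]
      refine (abs_add_le _ _).trans ?_
      rw [abs_of_nonneg hc0]
      have := (abs_log_le_of_mem_boundedPart hN hz h).2
      have := abs_nonneg M
      linarith
  · rw [truncLogTilt, if_neg hz, abs_zero]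
    have := abs_nonneg M
    positivity

lemma tilt_nonneg (h0 : ∀ z, 0 ≤ Z z) (z : X × Y) : 0 ≤ tilt c ε Z z :=
  mul_nonneg (h0 z) (Real.exp_pos _).le

lemma log_tilt {z : X × Y} (h : Z z ≠ 0) :
    Real.log (tilt c ε Z z) = Real.log (Z z) + 1 / ε * c z := by
  rw [tilt, Real.log_mul h (Real.exp_pos _).ne', Real.log_exp]

/-- Where all four densities are positive this is the logarithm of the defining inequality. If Z
vanishes at `w.1` or `w.2`, the value -M outweighs the other terms: their worst case is 3 log N +
2N/ε. -/
lemma truncLogTilt_exchange_neg (hε : 0 < ε) (hN : 1 ≤ N) (h0 : ∀ z, 0 ≤ Z z)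
    (hM : 3 * Real.log N + 2 * (1 / ε * N) < M) {w : (X × Y) × (X × Y)}
    (hw : w ∈ exchangeSet c ε Z N) :
    truncLogTilt c ε Z N M w.1 + truncLogTilt c ε Z N M w.2 -
      truncLogTilt c ε Z N M (exchange w).1 - truncLogTilt c ε Z N M (exchange w).2 < 0 := by
  obtain ⟨⟨m1, m2⟩, ⟨m3, m4⟩, hlt⟩ := hw
  have hl := Real.log_nonneg hN
  have he : 0 < 1 / ε := by positivity
  -- The larger product is strictly positive, so Z vanishes at neither exchanged point.
  have hpos := (mul_nonneg (tilt_nonneg h0 w.1) (tilt_nonneg h0 w.2)).trans_lt hlt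
  have n3 : Z (exchange w).1 ≠ 0 := fun h => by simp [tilt, h] at hpos
  have n4 : Z (exchange w).2 ≠ 0 := fun h => by simp [tilt, h] at hpos
  have hc1 : ∀ z ∈ boundedPart c Z N, 0 ≤ 1 / ε * (c z : ℝ) ∧ 1 / ε * (c z : ℝ) ≤ 1 / ε * N :=
    fun z hz => ⟨by positivity, mul_le_mul_of_nonneg_left hz.2.2 he.le⟩
  have upper : ∀ z ∈ boundedPart c Z N, truncLogTilt c ε Z N M z ≤ Real.log N + 1 / ε * N := by
    intro z hz
    have := hc1 z hz
    by_cases h : Z z = 0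
    · rw [truncLogTilt_of_eq hz h]
      have : 0 ≤ 1 / ε * N := by positivity
      linarith
    · rw [truncLogTilt_of_ne hz h]
      have := abs_le.1 (abs_log_le_of_mem_boundedPart hN hz h).2
      linarith
  have lower : ∀ z ∈ boundedPart c Z N, Z z ≠ 0 → -Real.log N ≤ truncLogTilt c ε Z N M z := by
    intro z hz h
    rw [truncLogTilt_of_ne hz h]
    have := abs_le.1 (abs_log_le_of_mem_boundedPart hN hz h).2
    have := hc1 z hz
    linarith
  have zero : ∀ z ∈ boundedPart c Z N, Z z = 0 → truncLogTilt c ε Z N M z ≤ -M + 1 / ε * N := by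
    intro z hz h
    rw [truncLogTilt_of_eq hz h]
    have := hc1 z hz
    linarith
  have l3 := lower _ m3 n3
  have l4 := lower _ m4 n4
  by_cases h1 : Z w.1 = 0
  · have := zero _ m1 h1
    have := upper _ m2
    linarith
  by_cases h2 : Z w.2 = 0
  · have := zero _ m2 h2
    have := upper _ m1
    linarith
  have tne : ∀ z, Z z ≠ 0 → tilt c ε Z z ≠ 0 := fun z hz => mul_ne_zero hz (Real.exp_pos _).ne'
  have hpos1 : 0 < tilt c ε Z w.1 * tilt c ε Z w.2 :=
    (mul_nonneg (tilt_nonneg h0 w.1) (tilt_nonneg h0 w.2)).lt_of_ne'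
      (mul_ne_zero (tne _ h1) (tne _ h2))
  have := Real.log_lt_log hpos1 hlt
  rw [Real.log_mul (tne _ h1) (tne _ h2), Real.log_mul (tne _ n3) (tne _ n4), log_tilt h1,
    log_tilt h2, log_tilt n3, log_tilt n4] at this
  rw [truncLogTilt_of_ne m1 h1, truncLogTilt_of_ne m2 h2, truncLogTilt_of_ne m3 n3,
    truncLogTilt_of_ne m4 n4]
  linarith

variable {μ : Measure X} [IsProbabilityMeasure μ] {ν : Measure Y} [IsProbabilityMeasure ν]

lemma exchangeDensity_eq_zero {z : X × Y} (hz : z ∉ boundedPart c Z N) :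
    exchangeDensity μ ν (exchangeSet c ε Z N) z = 0 := by
  have h1 : Prod.mk z ⁻¹' exchangeSet c ε Z N = ∅ :=
    Set.eq_empty_of_forall_notMem fun z' h => hz h.1.1
  have h2 : Prod.mk z ⁻¹' (exchange ⁻¹' exchangeSet c ε Z N) = ∅ :=
    Set.eq_empty_of_forall_notMem fun z' h => hz h.2.1.1
  rw [exchangeDensity, h1, h2, sub_self]

/-- Mass is taken only from points where Z is positive, which keeps the perturbed density
nonnegative. -/
lemma exchangeDensity_nonneg (h0 : ∀ z, 0 ≤ Z z) {z : X × Y} (hz : Z z = 0) :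
    0 ≤ exchangeDensity μ ν (exchangeSet c ε Z N) z := by
  have h2 : Prod.mk z ⁻¹' (exchange ⁻¹' exchangeSet c ε Z N) = ∅ := by
    refine Set.eq_empty_of_forall_notMem fun z' h => ?_
    have hpos := (mul_nonneg (tilt_nonneg h0 _) (tilt_nonneg h0 _)).trans_lt h.2.2
    simp [tilt, hz] at hpos
  rw [exchangeDensity, h2, measureReal_empty, sub_zero]
  exact measureReal_nonneg

/-- First order expansion of the entropic integrand along the exchange of mass. -/
lemma entropicIntegrand_add_exchangeDensity_le (hε : 0 < ε) (hN : 1 ≤ N) (h0 : ∀ z, 0 ≤ Z z)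
    {t : ℝ} (ht : 0 < t) (htN : t ≤ 1 / (2 * N)) (htM : t ≤ Real.exp (-M)) (z : X × Y) :
    0 ≤ Z z + t * exchangeDensity μ ν (exchangeSet c ε Z N) z ∧
    entropicIntegrand c ε z (Z z + t * exchangeDensity μ ν (exchangeSet c ε Z N) z) ≤
      entropicIntegrand c ε z (Z z) + (ε * t * (truncLogTilt c ε Z N M z *
        exchangeDensity μ ν (exchangeSet c ε Z N) z) + 2 * N * ε * t ^ 2) := by
  have hd := abs_exchangeDensity_le_one μ ν (S := exchangeSet c ε Z N) z
  have hnn := exchangeDensity_nonneg (μ := μ) (ν := ν) (c := c) (ε := ε) (N := N) h0 (z := z)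
  have hzero := exchangeDensity_eq_zero (μ := μ) (ν := ν) (c := c) (ε := ε) (Z := Z) (N := N)
    (z := z)
  set d := exchangeDensity μ ν (exchangeSet c ε Z N) z with hd_def
  have hN0 : 0 < N := by linarith
  have hrem : 0 ≤ 2 * N * ε * t ^ 2 := by positivity
  by_cases hd0 : d = 0
  · simp [hd0, h0 z, hrem]
  have hz : z ∈ boundedPart c Z N := by
    by_contra h; exact hd0 (hzero h)
  by_cases hZ : Z z = 0
  · have hdpos : 0 < d := (hnn hZ).lt_of_ne' hd0
    have hr : 0 < t * d := mul_pos ht hdpos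
    -- At a zero of Z the slope is log(td), at most -M because d ≤ 1 and t ≤ exp(-M): this is why -M
    -- may stand in for log 0.
    have hlog : Real.log (t * d) ≤ -M := by
      rw [← Real.log_exp (-M)]
      refine Real.log_le_log hr (le_trans ?_ htM)
      exact mul_le_of_le_one_right ht.le (abs_le.1 hd).2
    rw [hZ, zero_add]
    refine ⟨hr.le, ?_⟩
    have h1 := klFun_sub_le le_rfl hr
    have h2 : klFun (t * d) - klFun 0 ≤ (t * d) * -M := by
      refine h1.trans ?_
      rw [sub_zero]
      exact mul_le_mul_of_nonneg_left hlog hr.le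
    have h3 := mul_le_mul_of_nonneg_left h2 hε.le
    rw [truncLogTilt_of_eq hz hZ]
    simp only [entropicIntegrand]
    have e : ε * t * ((-M + 1 / ε * c z) * d) = ε * (t * d * -M) + c z * (t * d) := by
      field_simp
    rw [e]
    linarith
  · obtain ⟨hs0, -⟩ := abs_log_le_of_mem_boundedPart hN hz hZ
    obtain ⟨h1, h2⟩ := mul_log_add_mul_le hN0 (hz.1.resolve_left hZ) hd ht htN
    have hr : 0 < Z z + t * d := by linarith
    refine ⟨hr.le, ?_⟩
    have h3 := klFun_sub_le hs0.le hr
    rw [add_sub_cancel_left] at h3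
    have h4 := mul_le_mul_of_nonneg_left h2 ht.le
    have h5 := mul_le_mul_of_nonneg_left (h3.trans_eq (mul_assoc _ _ _) |>.trans h4) hε.le
    rw [truncLogTilt_of_ne hz hZ]
    simp only [entropicIntegrand]
    have e : ε * t * ((Real.log (Z z) + 1 / ε * c z) * d) =
        ε * (t * (d * Real.log (Z z))) + c z * (t * d) := by
      field_simp
    rw [e]
    nlinarith

/-- Moving mass t along the exchange changes the cost by at most εt ∫ f d + O(t²). Minimality forces
∫ f d ≥ 0, yet symmetrized it is half the integral over S of a strictly negative function; so S is
null. -/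
lemma measure_exchangeSet_eq_zero (hc : Measurable c) (hε : 0 < ε) (hN : 1 ≤ N)
    (hZ : IsCouplingDensity μ ν Z)
    (hfin : entropicCost c ε μ ν (ofDensity μ ν Z) ≠ ∞)
    (hmin : ∀ π ∈ couplings μ ν, entropicCost c ε μ ν (ofDensity μ ν Z) ≤ entropicCost c ε μ ν π) :
    ((μ.prod ν).prod (μ.prod ν)) (exchangeSet c ε Z N) = 0 := by
  set M := 3 * Real.log N + 2 * (1 / ε * N) + 1 with hM
  set S := exchangeSet c ε Z N with hSdef
  set f := truncLogTilt c ε Z N M with hf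
  set d := exchangeDensity μ ν S with hd
  have hN0 : 0 < N := by linarith
  have hS : MeasurableSet S := measurableSet_exchangeSet hc hZ.measurable
  have hsw : Prod.swap ⁻¹' S = S := swap_preimage_exchangeSet
  have hfm : Measurable f := measurable_truncLogTilt hc hZ.measurable
  have hfb := abs_truncLogTilt_le (c := c) (Z := Z) (M := M) hε hN
  have hdm : Measurable d := measurable_exchangeDensity μ ν hS
  have hd1 := abs_exchangeDensity_le_one μ ν (S := S)
  have hJm := measurable_entropicIntegrand (ε := ε) hc hZ.measurable
  have hJ0 : ∀ z, 0 ≤ entropicIntegrand c ε z (Z z) := fun z =>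
    entropicIntegrand_nonneg hε.le (hZ.nonneg z) z
  have hJi : Integrable (fun z => entropicIntegrand c ε z (Z z)) (μ.prod ν) := by
    refine ⟨hJm.aestronglyMeasurable, ?_⟩
    rw [hasFiniteIntegral_iff_ofReal (Eventually.of_forall hJ0), lt_top_iff_ne_top,
      ← entropicCost_ofDensity hc hε.le hZ]
    exact hfin
  have hfd : Integrable (fun z => f z * d z) (μ.prod ν) := by
    refine integrable_of_abs_le (C := |M| + Real.log N + 1 / ε * N) (hfm.mul hdm) fun z => ?_
    rw [abs_mul]
    exact (mul_le_of_le_one_right (abs_nonneg _) (hd1 z)).trans (hfb z)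
  -- The finite cost of Z cancels from both sides, and the rest is divided by εt.
  have step : ∀ t, 0 < t → t ≤ 1 / (2 * N) → t ≤ Real.exp (-M) →
      0 ≤ ∫ z, f z * d z ∂(μ.prod ν) + 2 * N * t := by
    intro t ht htN htM
    have hpt := entropicIntegrand_add_exchangeDensity_le (μ := μ) (ν := ν) (c := c) hε hN
      hZ.nonneg ht htN htM
    have hZt := hZ.add_exchangeDensity hS hsw fun z => (hpt z).1
    have hle := hmin _ hZt.mem_couplings
    rw [entropicCost_ofDensity hc hε.le hZ, entropicCost_ofDensity hc hε.le hZt] at hle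
    have hle2 : _ ≤ ∫⁻ z, ENNReal.ofReal (entropicIntegrand c ε z (Z z) +
        (ε * t * (f z * d z) + 2 * N * ε * t ^ 2)) ∂(μ.prod ν) :=
      hle.trans (lintegral_mono fun z => ENNReal.ofReal_le_ofReal (hpt z).2)
    have hi2 : Integrable (fun z => ε * t * (f z * d z) + 2 * N * ε * t ^ 2) (μ.prod ν) :=
      (hfd.const_mul _).add (integrable_const _)
    have hi3 : Integrable (fun z => entropicIntegrand c ε z (Z z) +
        (ε * t * (f z * d z) + 2 * N * ε * t ^ 2)) (μ.prod ν) := hJi.add hi2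
    have hnn : ∀ z, 0 ≤ entropicIntegrand c ε z (Z z) +
        (ε * t * (f z * d z) + 2 * N * ε * t ^ 2) := fun z =>
      (entropicIntegrand_nonneg hε.le (hpt z).1 z).trans (hpt z).2
    rw [← ofReal_integral_eq_lintegral_ofReal hJi (Eventually.of_forall hJ0),
      ← ofReal_integral_eq_lintegral_ofReal hi3 (Eventually.of_forall hnn),
      ENNReal.ofReal_le_ofReal_iff (integral_nonneg hnn), integral_add hJi hi2,
      integral_add (hfd.const_mul _) (integrable_const _), integral_const_mul, integral_const,
      probReal_univ, one_smul] at hle2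
    have h3 : 0 ≤ (ε * t) * (∫ z, f z * d z ∂(μ.prod ν) + 2 * N * t) := by
      linarith
    exact nonneg_of_mul_nonneg_right h3 (mul_pos hε ht)
  have hI : 0 ≤ ∫ z, f z * d z ∂(μ.prod ν) := by
    have hlim : Tendsto (fun t : ℝ => ∫ z, f z * d z ∂(μ.prod ν) + 2 * N * t) (𝓝[>] 0)
        (𝓝 (∫ z, f z * d z ∂(μ.prod ν) + 2 * N * 0)) :=
      (Continuous.tendsto (by fun_prop) 0).mono_left nhdsWithin_le_nhds
    rw [mul_zero, add_zero] at hlim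
    refine ge_of_tendsto hlim ?_
    filter_upwards [self_mem_nhdsWithin,
      nhdsWithin_le_nhds (Iic_mem_nhds (show (0 : ℝ) < 1 / (2 * N) by positivity)),
      nhdsWithin_le_nhds (Iic_mem_nhds (Real.exp_pos (-M)))] with t h1 h2 h3
    exact step t h1 h2 h3
  have h2I := two_mul_integral_mul_exchangeDensity hS hsw hfm hfb (μ := μ) (ν := ν)
  set g : (X × Y) × (X × Y) → ℝ := fun w =>
    f w.1 + f w.2 - f (exchange w).1 - f (exchange w).2 with hg
  have hneg : ∀ w ∈ S, g w < 0 := fun w hw =>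
    truncLogTilt_exchange_neg hε hN hZ.nonneg (by rw [hM]; linarith) hw
  have hgi : Integrable g (((μ.prod ν).prod (μ.prod ν)).restrict S) := by
    have hi : ∀ {k : (X × Y) × (X × Y) → X × Y}, Measurable k →
        Integrable (fun w => f (k w)) (((μ.prod ν).prod (μ.prod ν)).restrict S) := fun hk =>
      (integrable_of_abs_le (hfm.comp hk) fun w => hfb _)
    exact (((hi measurable_fst).add (hi measurable_snd)).sub
      (hi (measurable_fst.comp measurable_exchange))).sub
      (hi (measurable_snd.comp measurable_exchange))
  have hae : ∀ᵐ w ∂((μ.prod ν).prod (μ.prod ν)).restrict S, w ∈ S := ae_restrict_mem hS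
  have hnn : 0 ≤ᵐ[((μ.prod ν).prod (μ.prod ν)).restrict S] fun w => -g w :=
    hae.mono fun w hw => by simpa using (hneg w hw).le
  have hz : ∫ w in S, -g w ∂((μ.prod ν).prod (μ.prod ν)) = 0 := by
    refine le_antisymm ?_ (integral_nonneg_of_ae hnn)
    rw [integral_neg, ← h2I]
    linarith
  have h0 := (integral_eq_zero_iff_of_nonneg_ae hnn hgi.neg).1 hz
  rw [← Measure.restrict_eq_zero, ← ae_eq_bot]
  refine Filter.eventually_false_iff_eq_bot.1 ?_
  filter_upwards [h0, hae] with w h1 h2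
  have := hneg w h2
  simp only [Pi.zero_apply] at h1
  linarith

lemma eventually_mem_boundedPart (h0 : ∀ z, 0 ≤ Z z) (z : X × Y) :
    ∀ᶠ n : ℕ in atTop, z ∈ boundedPart c Z n := by
  have h := tendsto_natCast_atTop_atTop (R := ℝ)
  filter_upwards [h.eventually_ge_atTop (Z z), h.eventually_ge_atTop (c z : ℝ),
    h.eventually_ge_atTop (1 / Z z)] with n h1 h2 h3
  refine ⟨?_, h1, h2⟩
  rcases (h0 z).eq_or_lt with h | h
  · exact Or.inl h.symm
  · exact Or.inr ((one_div_le (h.trans_le h1) h).2 h3)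

/-- The density of a minimizer satisfies the cyclical identity for almost all pairs of points. -/
lemma ae_tilt_exchange_eq (hc : Measurable c) (hε : 0 < ε) (hZ : IsCouplingDensity μ ν Z)
    (hfin : entropicCost c ε μ ν (ofDensity μ ν Z) ≠ ∞)
    (hmin : ∀ π ∈ couplings μ ν, entropicCost c ε μ ν (ofDensity μ ν Z) ≤ entropicCost c ε μ ν π) :
    ∀ᵐ w ∂((μ.prod ν).prod (μ.prod ν)),
      tilt c ε Z w.1 * tilt c ε Z w.2 = tilt c ε Z (exchange w).1 * tilt c ε Z (exchange w).2 := by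
  have hle : ∀ᵐ w ∂((μ.prod ν).prod (μ.prod ν)),
      tilt c ε Z (exchange w).1 * tilt c ε Z (exchange w).2 ≤ tilt c ε Z w.1 * tilt c ε Z w.2 := by
    have hnull : ∀ᵐ w ∂((μ.prod ν).prod (μ.prod ν)), ∀ n : ℕ, 1 ≤ n → w ∉ exchangeSet c ε Z n := by
      rw [ae_all_iff]
      intro n
      by_cases hn : 1 ≤ n
      · have h := measure_exchangeSet_eq_zero hc hε (Nat.one_le_cast.2 hn) hZ hfin hmin
        filter_upwards [measure_eq_zero_iff_ae_notMem.1 h] with w hw _ using hw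
      · exact Eventually.of_forall fun w h => absurd h hn
    filter_upwards [hnull] with w hw
    by_contra! hlt
    obtain ⟨n, h1, h2, h3, h4, h5⟩ := ((eventually_ge_atTop 1).and
      ((eventually_mem_boundedPart (c := c) hZ.nonneg w.1).and
      ((eventually_mem_boundedPart (c := c) hZ.nonneg w.2).and
      ((eventually_mem_boundedPart (c := c) hZ.nonneg (exchange w).1).and
      (eventually_mem_boundedPart (c := c) hZ.nonneg (exchange w).2))))).exists
    exact hw n h1 ⟨⟨h2, h3⟩, ⟨h4, h5⟩, hlt⟩
  -- `exchange` is a measure-preserving involution, so the inequality at `exchange w` is the reverse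
  -- one at `w`.
  filter_upwards [hle, (measurePreserving_exchange μ ν).quasiMeasurePreserving.ae hle] with w h1 h2
  exact le_antisymm h2 h1

end FirstOrder

/-! ### From minimizers to cyclical invariance -/

section Characterization

variable {μ : Measure X} [IsProbabilityMeasure μ] {ν : Measure Y} [IsProbabilityMeasure ν]
  {c : X × Y → ℝ≥0} {ε : ℝ} {Z : X × Y → ℝ}

/-- The set where a ≤ 0 has μ-measure equal to the mass of Z above it, which is zero. -/
lemma IsCouplingDensity.ae_pos_fst (hZ : IsCouplingDensity μ ν Z) {a : X → ℝ} (ha : Measurable a)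
    (h : ∀ᵐ z ∂(μ.prod ν), a z.1 ≤ 0 → Z z = 0) : ∀ᵐ x ∂μ, 0 < a x := by
  have hA : MeasurableSet {x | a x ≤ 0} := measurableSet_le ha measurable_const
  have h0 : ∫ z in Prod.fst ⁻¹' {x | a x ≤ 0}, Z z ∂(μ.prod ν) = 0 := by
    rw [setIntegral_congr_ae (g := fun _ => 0) (measurable_fst hA) h, integral_zero]
  rw [hZ.setIntegral_fst _ hA, measureReal_eq_zero_iff] at h0
  filter_upwards [measure_eq_zero_iff_ae_notMem.1 h0] with x hx
  exact not_le.1 hx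

lemma IsCouplingDensity.ae_pos_snd (hZ : IsCouplingDensity μ ν Z) {b : Y → ℝ} (hb : Measurable b)
    (h : ∀ᵐ z ∂(μ.prod ν), b z.2 ≤ 0 → Z z = 0) : ∀ᵐ y ∂ν, 0 < b y := by
  have hB : MeasurableSet {y | b y ≤ 0} := measurableSet_le hb measurable_const
  have h0 : ∫ z in Prod.snd ⁻¹' {y | b y ≤ 0}, Z z ∂(μ.prod ν) = 0 := by
    rw [setIntegral_congr_ae (g := fun _ => 0) (measurable_snd hB) h, integral_zero]
  rw [hZ.setIntegral_snd _ hB, measureReal_eq_zero_iff] at h0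
  filter_upwards [measure_eq_zero_iff_ae_notMem.1 h0] with y hy
  exact not_le.1 hy

lemma isCyclicallyInvariant_of_separable {a : X → ℝ} {b : Y → ℝ} (hc : Measurable c)
    (ha : Measurable a) (hb : Measurable b) (ha0 : ∀ x, 0 < a x) (hb0 : ∀ y, 0 < b y)
    (hZ : ∀ z, Z z = a z.1 * b z.2 * Real.exp (-(1 / ε) * c z))
    (hmem : ofDensity μ ν Z ∈ couplings μ ν) :
    IsCyclicallyInvariant c ε μ ν (ofDensity μ ν Z) := by
  have hpos : ∀ z, 0 < Z z := fun z => by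
    rw [hZ]; exact mul_pos (mul_pos (ha0 _) (hb0 _)) (Real.exp_pos _)
  have hm : Measurable Z := by
    have : Z = fun z => a z.1 * b z.2 * Real.exp (-(1 / ε) * c z) := funext hZ
    rw [this]; fun_prop
  refine ⟨hmem, withDensity_absolutelyContinuous _ _,
    withDensity_absolutelyContinuous' hm.ennreal_ofReal.aemeasurable
      (Eventually.of_forall fun z => by simpa using hpos z), Z, hm, hpos, rfl, fun k x y => ?_⟩
  simp_rw [hZ, Finset.prod_mul_distrib, ← Real.exp_sum, ← Finset.mul_sum]
  rw [Equiv.prod_comp (finRotate k) fun i => b (y i)]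
  have e : Real.exp (-(1 / ε) * ∑ i, (c (x i, y i) : ℝ)) =
      Real.exp (-(1 / ε) * (∑ i, (c (x i, y i) : ℝ) - ∑ i, (c (x i, y (finRotate k i)) : ℝ))) *
        Real.exp (-(1 / ε) * ∑ i, (c (x i, y (finRotate k i)) : ℝ)) := by
    rw [← Real.exp_add]; ring_nf
  rw [e]
  ring

theorem IsEntropicOptimal.isCyclicallyInvariant (hc : Measurable c) (hε : 0 < ε)
    {π : Measure (X × Y)} (hπ : IsEntropicOptimal c ε μ ν π)
    (hfin : entropicCost c ε μ ν π ≠ ∞) : IsCyclicallyInvariant c ε μ ν π := by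
  obtain ⟨hmem, hmin⟩ := hπ
  obtain ⟨Z, hZ, rfl⟩ := exists_eq_ofDensity hmem
    (absolutelyContinuous_of_entropicCost_ne_top hε hfin)
  have hm := hZ.measurable
  have hswap := ae_tilt_exchange_eq hc hε hZ hfin fun π hπ => hmin hπ
  have hfreq : ∃ᵐ z ∂(μ.prod ν), 0 < Z z := by
    intro hnot
    have h0 : ∫⁻ z, ENNReal.ofReal (Z z) ∂(μ.prod ν) = 0 := by
      rw [lintegral_congr_ae (g := fun _ => 0), lintegral_zero]
      filter_upwards [hnot] with z hz
      exact ENNReal.ofReal_of_nonpos (not_lt.1 hz)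
    rw [hZ.lintegral_eq_one] at h0
    exact one_ne_zero h0
  -- By Fubini almost every first point satisfies the identity with almost every second one, and Z
  -- is positive on a non-null set; so a positive anchor exists.
  obtain ⟨⟨x₀, y₀⟩, hz₀, hanchor⟩ :=
    (hfreq.and_eventually (Measure.ae_ae_of_ae_prod hswap)).exists
  have hW₀ : 0 < tilt c ε Z (x₀, y₀) := mul_pos hz₀ (Real.exp_pos _)
  set a : X → ℝ := fun x => tilt c ε Z (x, y₀) / tilt c ε Z (x₀, y₀) with ha_def
  set b : Y → ℝ := fun y => tilt c ε Z (x₀, y) with hb_def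
  have hW := measurable_tilt (ε := ε) hc hm
  have ha : Measurable a := by fun_prop
  have hb : Measurable b := by fun_prop
  have hann : ∀ x, 0 ≤ a x := fun x => div_nonneg (tilt_nonneg hZ.nonneg _) hW₀.le
  have hbnn : ∀ y, 0 ≤ b y := fun y => tilt_nonneg hZ.nonneg _
  have hsep : ∀ᵐ z ∂(μ.prod ν), Z z = a z.1 * b z.2 * Real.exp (-(1 / ε) * c z) := by
    filter_upwards [hanchor] with z hz
    have h1 : a z.1 * b z.2 = tilt c ε Z z := by
      simp only [exchange] at hz
      simp only [ha_def, hb_def]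
      rw [div_mul_eq_mul_div, div_eq_iff hW₀.ne']
      linear_combination -hz
    rw [h1, tilt, mul_assoc, ← Real.exp_add, neg_mul, add_neg_cancel, Real.exp_zero, mul_one]
  have hapos := hZ.ae_pos_fst ha (hsep.mono fun z hz h => by
    rw [hz, le_antisymm h (hann _), zero_mul, zero_mul])
  have hbpos := hZ.ae_pos_snd hb (hsep.mono fun z hz h => by
    rw [hz, le_antisymm h (hbnn _), mul_zero, zero_mul])
  classical
  -- The cyclical identity is required at all points, so the factors are made positive everywhere by
  -- a change on null sets.
  set a' : X → ℝ := fun x => if 0 < a x then a x else 1 with ha'_def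
  set b' : Y → ℝ := fun y => if 0 < b y then b y else 1 with hb'_def
  have ha' : Measurable a' := Measurable.ite (measurableSet_lt measurable_const ha) ha
    measurable_const
  have hb' : Measurable b' := Measurable.ite (measurableSet_lt measurable_const hb) hb
    measurable_const
  have ha0 : ∀ x, 0 < a' x := fun x => by
    simp only [ha'_def]; split_ifs with h
    exacts [h, one_pos]
  have hb0 : ∀ y, 0 < b' y := fun y => by
    simp only [hb'_def]; split_ifs with h
    exacts [h, one_pos]
  set Z' : X × Y → ℝ := fun z => a' z.1 * b' z.2 * Real.exp (-(1 / ε) * c z) with hZ'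
  have hae : Z =ᵐ[μ.prod ν] Z' := by
    filter_upwards [hsep, Measure.quasiMeasurePreserving_fst.ae hapos,
      Measure.quasiMeasurePreserving_snd.ae hbpos] with z hz h1 h2
    simp only [hZ', ha'_def, hb'_def, if_pos h1, if_pos h2]
    exact hz
  obtain ⟨heq, hcd⟩ := hZ.congr_ae (by fun_prop)
    (fun z => (mul_pos (mul_pos (ha0 _) (hb0 _)) (Real.exp_pos _)).le) hae
  rw [heq]
  exact isCyclicallyInvariant_of_separable hc ha' hb' ha0 hb0 (fun z => rfl) hcd.mem_couplings

end Characterization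

end EntropicOT

/-! ### The main theorem -/

theorem proposition2p2 {X Y : Type*}
    [TopologicalSpace X] [PolishSpace X] [MeasurableSpace X] [BorelSpace X]
    [TopologicalSpace Y] [PolishSpace Y] [MeasurableSpace Y] [BorelSpace Y]
    (μ : Measure X) [IsProbabilityMeasure μ] (ν : Measure Y) [IsProbabilityMeasure ν]
    (c : X × Y → ℝ≥0) (hc : Measurable c) (ε : ℝ) (hε : 0 < ε) :
    (∀ π π' : Measure (X × Y),
      EntropicOT.IsCyclicallyInvariant c ε μ ν π →
      EntropicOT.IsCyclicallyInvariant c ε μ ν π' → π = π') ∧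
    ((∃ π ∈ EntropicOT.couplings μ ν,
        (∫⁻ z, (c z : ℝ≥0∞) ∂π) + InformationTheory.klDiv π (μ.prod ν) < ∞) →
      (∀ π ∈ EntropicOT.couplings μ ν,
        EntropicOT.IsCyclicallyInvariant c ε μ ν π ↔
          EntropicOT.IsEntropicOptimal c ε μ ν π) ∧
      ∃! π : Measure (X × Y), EntropicOT.IsCyclicallyInvariant c ε μ ν π) := by
  -- The finiteness assumption carries weight 1 on the entropy, the objective carries ε; only
  -- finiteness of both terms matters.
  have hfinite : (∃ π ∈ EntropicOT.couplings μ ν,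
      (∫⁻ z, (c z : ℝ≥0∞) ∂π) + InformationTheory.klDiv π (μ.prod ν) < ∞) →
      ∃ π ∈ EntropicOT.couplings μ ν, EntropicOT.entropicCost c ε μ ν π ≠ ∞ := by
    rintro ⟨π, hπ, h⟩
    obtain ⟨h1, h2⟩ := ENNReal.add_lt_top.1 h
    exact ⟨π, hπ, ENNReal.add_ne_top.2 ⟨h1.ne, ENNReal.mul_ne_top ENNReal.ofReal_ne_top h2.ne⟩⟩
  refine ⟨fun π π' h h' => h.eq hc h', fun hex => ?_⟩
  obtain ⟨π₀, hπ₀, hfin₀⟩ := hfinite hex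
  have key : ∀ π, EntropicOT.IsEntropicOptimal c ε μ ν π →
      EntropicOT.IsCyclicallyInvariant c ε μ ν π := fun π h =>
    h.isCyclicallyInvariant hc hε ((h.2 hπ₀).trans_lt hfin₀.lt_top).ne
  obtain ⟨π₁, hopt⟩ := EntropicOT.exists_isEntropicOptimal hc hε ⟨π₀, hπ₀, hfin₀⟩
  refine ⟨fun π _ => ⟨fun h => ?_, key π⟩, π₁, key π₁ hopt, fun π h => h.eq hc (key π₁ hopt)⟩
  -- Optimality is not verified directly: the coupling equals the minimizer π₁ by uniqueness.
  rwa [h.eq hc (key π₁ hopt)]
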